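/- **Setting.** Let $x_1,x_2,\dots$ be i.i.d. random elements of a measurable space $\mathcal X$ with law $P_X$, let $\epsilon_1,\epsilon_2,\dots$ be i.i.d. real random variables with mean $0$ and variance $1$, and let $y_i=f_0(x_i)+\epsilon_i$, where $f_0$ belongs to a reproducing kernel Hilbert space $\mathcal H$ of real functions on $\mathcal X$ with kernel $K(x,x')=\sum_{i\ge1}\mu_i\phi_i(x)\phi_i(x')$. Here $\mu_1\ge\mu_2\ge\cdots>0$, the $\phi_i$ are measurable and orthonormal in $L^2(P_X)$, $\sup_i\|\phi_i\|_{\sup}<\infty$ and $\sup_{k\ge1}\sum_{i>k}\mu_i/(k\mu_k)<\infty$. For each $n$ let $\lambda=\lambda_n$ be a real number, $s=s_n$ a natural number, and $S=S_n$ a random real $s\times n$ matrix such that $(x_1,\dots,x_n,S)$ is independent of $(\epsilon_1,\dots,\epsilon_n)$. Put $\mathbf K=[n^{-1}K(x_i,x_j)]_{i,j\le n}$, $\mathbf y=(y_1,\dots,y_n)^\top$, and let $s_\lambda$ be the number of $\mu_i$ greater than $\lambda$. The sketched kernel ridge regression estimator is $\hat f_R=\sum_{i=1}^n(S^\top\hat\beta)_iK(\cdot,x_i)$,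 where $\hat\beta$ minimizes $$\beta^\top S\mathbf K^2S^\top\beta-\tfrac2n\beta^\top S\mathbf K\mathbf y+\lambda\,\beta^\top S\mathbf KS^\top\beta\qquad(\beta\in\mathbb R^s).$$ Let $\Delta=\mathbf KS^\top(S\mathbf K^2S^\top+\lambda S\mathbf KS^\top)^{-1}S\mathbf K$ (with the Moore–Penrose inverse if the matrix in parentheses is singular), $\mu_{n,\lambda}=\operatorname{tr}(\Delta^2)/n$, and $\|g\|_n^2=\frac1n\sum_{i=1}^ng(x_i)^2$. **Condition on $S$.** Write $\mathbf K=UDU^\top$ with $U$ orthogonal and $D$ diagonal, let $U_1$ consist of the columns of $U$ belonging to eigenvalues greater than $\lambda$, and let $U_2$ and $D_2$ consist of the remaining columns and the diagonal matrix of their eigenvalues. For a constant $c>0$, $S$ is called $\mathbf K$-satisfiable if $\|(SU_1)^\top SU_1-I\|_{\rm op}\le\frac12$ and $\|SU_2D_2^{1/2}\|_{\rm op}\le c\lambda^{1/2}$. Assume that there are constants $d\in(0,\infty)$ and $c_1,c_2\in(0,\infty]$ such that for all large $n$: (a) $s\ge d\,s_\lambda$; (b) with $e^{-\infty}=0$ and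 $\infty\cdot0=0$, $$P\Big(P\big(S\text{ is }\mathbf K\text{-satisfiable}\,\big|\,x_1,\dots,x_n\big)\ge1-e^{-c_1s}\Big)\ge1-e^{-c_2s_\lambda}.$$ **Corollary 4.4.** For all real $R$ and $c>0$ there is a constant $C>0$, depending only on $R$ and $c$, such that the following holds in every setting as above with $\|f_0\|_{\mathcal H}\le R$. If $1/n<\lambda<1$ for all large $n$, the condition on $S$ holds with the constant $c$, and $c_1s\to\infty$ and $c_2s_\lambda\to\infty$ as $n\to\infty$ (a requirement met, for instance, whenever $\lambda\to0$), then $$\lim_{n\to\infty}P\Big(\|\hat f_R-f_0\|_n^2\le C\,(\lambda+\mu_{n,\lambda})\Big)=1.$$ -/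

import Mathlib

open MeasureTheory ProbabilityTheory Filter Topology
open scoped ENNReal Matrix

namespace SketchedKRR

noncomputable section

/-- The real-valued reproducing kernel `K(x, x')` of a reproducing kernel Hilbert space of
real functions on `X` (Mathlib's `RKHS.kernel` is valued in the operators `ℝ →L[ℝ] ℝ`). -/
def reproducingKernel {X : Type*} (H : Type*) [NormedAddCommGroup H] [InnerProductSpace ℝ H]
    [CompleteSpace H] [RKHS ℝ H X ℝ] (x x' : X) : ℝ :=
  RKHS.kernel H x x' 1

lemma reproducingKernel_symm {X : Type*} (H : Type*) [NormedAddCommGroup H]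
    [InnerProductSpace ℝ H] [CompleteSpace H] [RKHS ℝ H X ℝ] (x x' : X) :
    reproducingKernel H x x' = reproducingKernel H x' x := by
  have h : ∀ y z : X, reproducingKernel H y z
      = inner ℝ (RKHS.kerFun H z (1 : ℝ)) (RKHS.kerFun H y (1 : ℝ)) := fun y z => by
    rw [← RKHS.kernel_inner]
    simp [reproducingKernel]
  rw [h, h, real_inner_comm]

/-- The spectral (Mercer) expansion `k(x, x') = ∑ᵢ μᵢ φᵢ(x) φᵢ(x')` with respect to `ν`, where
the positive eigenvalues `μ 0 ≥ μ 1 ≥ ...` are indexed from `0`. -/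
structure IsMercerExpansion {X : Type*} [MeasurableSpace X] (ν : Measure X) (k : X → X → ℝ)
    (μ : ℕ → ℝ) (φ : ℕ → X → ℝ) : Prop where
  pos : ∀ i, 0 < μ i
  antitone : Antitone μ
  measurable : ∀ i, Measurable (φ i)
  orthonormal : ∀ i j, ∫ t, φ i t * φ j t ∂ν = if i = j then 1 else 0
  expansion : ∀ t t', HasSum (fun i => μ i * φ i t * φ i t') (k t t')

/-- Uniformly bounded eigenfunctions, and `sup_{k ≥ 1} (∑_{i > k} μᵢ) / (k μₖ) < ∞`
(here `μ k` is the `(k+1)`-st eigenvalue). -/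
structure HasRegularSpectrum {X : Type*} (μ : ℕ → ℝ) (φ : ℕ → X → ℝ) : Prop where
  bounded : ∃ cK : ℝ, ∀ i t, |φ i t| ≤ cK
  summable : Summable μ
  tail : ∃ B : ℝ, ∀ k : ℕ, (∑' i, μ (k + 1 + i)) / (((k : ℝ) + 1) * μ k) ≤ B

/-- `s_λ`, the number of eigenvalues `μᵢ` greater than `λ`. -/
def effDim (μ : ℕ → ℝ) (lam : ℝ) : ℕ := Set.ncard {i | lam < μ i}

/-- The normalized kernel matrix `[n⁻¹ k(xᵢ, xⱼ)]`. -/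
def kernelMatrix {X : Type*} {n : ℕ} (k : X → X → ℝ) (x : Fin n → X) :
    Matrix (Fin n) (Fin n) ℝ :=
  Matrix.of fun i j => (n : ℝ)⁻¹ * k (x i) (x j)

/-- The squared empirical norm `‖g‖ₙ² = n⁻¹ ∑ᵢ g(xᵢ)²`. -/
def empNormSq {X : Type*} {n : ℕ} (x : Fin n → X) (g : X → ℝ) : ℝ :=
  (n : ℝ)⁻¹ * ∑ i, g (x i) ^ 2

/-- The objective function of sketched kernel ridge regression,
`βᵀ (S K)(K Sᵀ) β - (2 / n) βᵀ S K y + λ βᵀ S K Sᵀ β`. -/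
def sketchObjective {n s : ℕ} (K : Matrix (Fin n) (Fin n) ℝ) (S : Matrix (Fin s) (Fin n) ℝ)
    (lam : ℝ) (y : Fin n → ℝ) (β : Fin s → ℝ) : ℝ :=
  β ⬝ᵥ (((S * K) * (K * Sᵀ)) *ᵥ β) - 2 / (n : ℝ) * (β ⬝ᵥ ((S * K) *ᵥ y))
    + lam * (β ⬝ᵥ ((S * K * Sᵀ) *ᵥ β))

/-- `f` is the sketched kernel ridge regression estimator
`∑ᵢ (Sᵀ β̂)ᵢ k(·, xᵢ)`, with `β̂` a minimizer of the objective function. -/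
def IsSketchedKRR {X : Type*} {n s : ℕ} (k : X → X → ℝ) (x : Fin n → X)
    (S : Matrix (Fin s) (Fin n) ℝ) (lam : ℝ) (y : Fin n → ℝ) (f : X → ℝ) : Prop :=
  ∃ β : Fin s → ℝ,
    (∀ β' : Fin s → ℝ, sketchObjective (kernelMatrix k x) S lam y β ≤
      sketchObjective (kernelMatrix k x) S lam y β') ∧
    ∀ t, f t = ∑ i, (Sᵀ *ᵥ β) i * k t (x i)

/-- The Moore-Penrose inverse of a real symmetric matrix: its nonzero eigenvalues are inverted,
the eigenvalue `0` is kept. -/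
def symmPinv {m : ℕ} (M : Matrix (Fin m) (Fin m) ℝ) : Matrix (Fin m) (Fin m) ℝ :=
  cfc (fun t : ℝ => t⁻¹) M

/-- On invertible symmetric matrices, `symmPinv` is the ordinary inverse. -/
lemma symmPinv_eq_inv {m : ℕ} {M : Matrix (Fin m) (Fin m) ℝ} (hM : M.IsHermitian)
    (hdet : IsUnit M.det) : symmPinv M = M⁻¹ := by
  have hsa : IsSelfAdjoint M := hM
  have hu : IsUnit M := (Matrix.isUnit_iff_isUnit_det M).2 hdet
  have h0 : (0 : ℝ) ∉ spectrum ℝ M := spectrum.zero_notMem ℝ hu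
  have hmul : M * symmPinv M = 1 := by
    have hc : ContinuousOn (fun t : ℝ => t⁻¹) (spectrum ℝ M) :=
      continuousOn_inv₀.mono fun t ht h => h0 (h ▸ ht)
    have h1 : cfc (fun t : ℝ => t * t⁻¹) M = M * symmPinv M := by
      rw [cfc_mul (fun t : ℝ => t) (fun t : ℝ => t⁻¹) M (by fun_prop) hc, cfc_id' ℝ M]
      rfl
    rw [← h1, cfc_congr (g := fun _ : ℝ => (1 : ℝ))
      (fun t ht => mul_inv_cancel₀ (fun h => h0 (h ▸ ht)))]
    exact cfc_const_one ℝ M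
  exact (Matrix.inv_eq_right_inv hmul).symm

/-- `Δ = K Sᵀ (S K² Sᵀ + λ S K Sᵀ)⁻¹ S K`; where the middle matrix is singular its
Moore-Penrose inverse is taken. -/
def smoother {n s : ℕ} (K : Matrix (Fin n) (Fin n) ℝ) (S : Matrix (Fin s) (Fin n) ℝ)
    (lam : ℝ) : Matrix (Fin n) (Fin n) ℝ :=
  K * Sᵀ * symmPinv (S * (K * K) * Sᵀ + lam • (S * K * Sᵀ)) * (S * K)

/-- The variance term `μ_{n,λ} = tr(Δ²) / n`. -/
def varianceTerm {n s : ℕ} (K : Matrix (Fin n) (Fin n) ℝ) (S : Matrix (Fin s) (Fin n) ℝ)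
    (lam : ℝ) : ℝ :=
  (smoother K S lam * smoother K S lam).trace / (n : ℝ)

open scoped Matrix.Norms.L2Operator in
/-- `K`-satisfiability of `S` with constant `c`. In `K = U D Uᵀ`, the columns of `U` belonging to
eigenvalues greater than `λ` form `U₁`; the remaining columns and their eigenvalues form `U₂` and
`D₂`. The conditions are `‖(S U₁)ᵀ S U₁ - I‖ ≤ 1/2` and `‖S U₂ D₂^{1/2}‖ ≤ c λ^{1/2}`, where
`‖·‖` is the operator norm between Euclidean spaces. -/
def KSatisfiable {n s : ℕ} (K : Matrix (Fin n) (Fin n) ℝ) (S : Matrix (Fin s) (Fin n) ℝ)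
    (lam c : ℝ) : Prop :=
  ∃ hK : K.IsHermitian,
    let U : Matrix (Fin n) (Fin n) ℝ := hK.eigenvectorUnitary
    let U₁ : Matrix (Fin n) {i // lam < hK.eigenvalues i} ℝ := U.submatrix id Subtype.val
    let U₂ : Matrix (Fin n) {i // ¬ lam < hK.eigenvalues i} ℝ := U.submatrix id Subtype.val
    let sqrtD₂ : Matrix {i // ¬ lam < hK.eigenvalues i} {i // ¬ lam < hK.eigenvalues i} ℝ :=
      Matrix.diagonal fun i => √(hK.eigenvalues i.1)
    ‖(S * U₁)ᵀ * (S * U₁) - 1‖ ≤ 1 / 2 ∧ ‖S * U₂ * sqrtD₂‖ ≤ c * √lam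

/-- The existence of `hK` in `KSatisfiable` is no restriction for the kernel matrix of an RKHS. -/
lemma kernelMatrix_isHermitian {X : Type*} {n : ℕ} (H : Type*) [NormedAddCommGroup H]
    [InnerProductSpace ℝ H] [CompleteSpace H] [RKHS ℝ H X ℝ] (x : Fin n → X) :
    (kernelMatrix (reproducingKernel H) x).IsHermitian := by
  ext i j
  simp [kernelMatrix, reproducingKernel_symm H (x i) (x j)]

/-- `exp(-a)` for `a ∈ [0, ∞]`, with `exp(-∞) = 0`. -/
def expNeg (a : ℝ≥0∞) : ℝ := if a = ∞ then 0 else Real.exp (-a.toReal)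

/-- The event `E` is of `(a, b)`-type given the σ-algebra `m`:
`P(P(E | m) ≥ 1 - exp(-a)) ≥ 1 - exp(-b)`. -/
def IsOfType {Ω : Type*} [MeasurableSpace Ω] (P : Measure Ω) (m : MeasurableSpace Ω) (E : Set Ω)
    (a b : ℝ≥0∞) : Prop :=
  1 - expNeg b ≤ P.real {ω | 1 - expNeg a ≤ (P⟦E | m⟧) ω}

/-- The condition on the sketching matrices: for all large `n`, `s ≥ d s_λ`, and the event that
`S` is `K`-satisfiable (with a constant `c` that does not depend on `n`) is of
`(c₁ s, c₂ s_λ)`-type given the design points. -/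
structure SketchCondition {Ω X : Type*} [MeasurableSpace Ω] [MeasurableSpace X] (P : Measure Ω)
    (k : X → X → ℝ) (μ : ℕ → ℝ) (x : ℕ → Ω → X) (s : ℕ → ℕ)
    (S : ∀ n, Ω → Matrix (Fin (s n)) (Fin n) ℝ) (lam : ℕ → ℝ) (c d : ℝ) (c₁ c₂ : ℝ≥0∞) :
    Prop where
  dim : ∀ᶠ n in atTop, d * (effDim μ (lam n) : ℝ) ≤ (s n : ℝ)
  type : ∀ᶠ n in atTop, IsOfType P
    (MeasurableSpace.comap (fun ω (i : Fin n) => x i ω) MeasurableSpace.pi)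
    {ω | KSatisfiable (kernelMatrix k fun i : Fin n => x i ω) (S n ω) (lam n) c}
    (c₁ * (s n : ℝ≥0∞)) (c₂ * (effDim μ (lam n) : ℝ≥0∞))

end

end SketchedKRR

namespace SketchedKRR

/-! Every minimizer has fitted values `Δ y`, so with F the vector of values of `f₀` at the design
points the error vector is Δε − (F − ΔF): a noise part and a bias part, each bounded by a multiple
of n(λ + μ_{n,λ}) = nλ + tr(Δ²).

Bias (`KSatisfiable.bias_le`). Completing the square shows that ‖F − ΔF‖² is at most the penalized
least squares objective at any vector K Sᵀβ. Satisfiability supplies a β for which K Sᵀβ equals F in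
all eigendirections of K above λ and leaks little energy into the others; since ‖f₀‖ ≤ R, the
objective there is of order nλ.

Noise (`quadForm_tail`). The noise contributes εᵀAε with A = Δ², where ‖A‖²_F ≤ tr A because Δ is a
contraction. The noise has only two moments, so the variance of εᵀAε may be infinite. The
off-diagonal part still has finite second moment; in the diagonal part ε² is truncated at M, the
truncated sum is handled by Chebyshev and the remainder by Markov. With τ = tr A + nλ this gives
εᵀAε ≤ 4τ outside an event of probability at most δ + (2 + M²)/τ. As A is random but independent of
ε, Fubini reduces to fixed A.

The bound is useful only if τ is large, for any prescribed size T (`le_trace_add`). Either nλ ≥ T,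
or λ < T/n lies below half of a fixed eigenvalue `μ N` for large n. In the second case the law of
large numbers makes the first N eigenfunctions nearly orthonormal on the sample, so K has at least N
eigenvalues above λ (`le_card_topIdx`), and satisfiability makes each contribute a constant to
tr(Δ²) (`KSatisfiable.card_topIdx_le`). -/

/-- The matrix `S K² Sᵀ + λ S K Sᵀ` of the normal equations. -/
def normalMatrix {n s : ℕ} (K : Matrix (Fin n) (Fin n) ℝ) (S : Matrix (Fin s) (Fin n) ℝ)
    (lam : ℝ) : Matrix (Fin s) (Fin s) ℝ :=
  S * (K * K) * Sᵀ + lam • (S * K * Sᵀ)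

/-! ### Algebra of the Moore–Penrose inverse -/

/-- Matrix spectra are finite, so the functional calculus accepts t ↦ t⁻¹ despite its jump at 0. -/
lemma continuousOn_spectrum {m : ℕ} (M : Matrix (Fin m) (Fin m) ℝ) (f : ℝ → ℝ) :
    ContinuousOn f (spectrum ℝ M) :=
  (Matrix.finite_real_spectrum (A := M)).continuousOn f

lemma mul_symmPinv_mul {m : ℕ} {M : Matrix (Fin m) (Fin m) ℝ} (hM : M.IsHermitian) :
    M * symmPinv M * M = M := by
  have hsa : IsSelfAdjoint M := hM
  have h1 : cfc (fun t : ℝ => t * t⁻¹ * t) M = M * symmPinv M * M := by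
    rw [cfc_mul (fun t : ℝ => t * t⁻¹) (fun t : ℝ => t) M (continuousOn_spectrum M _)
      (continuousOn_spectrum M _), cfc_mul (fun t : ℝ => t) (fun t : ℝ => t⁻¹) M
      (continuousOn_spectrum M _) (continuousOn_spectrum M _), cfc_id' ℝ M]
    rfl
  rw [← h1]
  simp only [mul_inv_mul_cancel]
  exact cfc_id' ℝ M

lemma symmPinv_transpose {m : ℕ} (M : Matrix (Fin m) (Fin m) ℝ) :
    (symmPinv M)ᵀ = symmPinv M := by
  have h : IsSelfAdjoint (symmPinv M) := cfc_predicate _ M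
  simpa [IsSelfAdjoint, Matrix.star_eq_conjTranspose] using h

/-! ### Normal equations and the smoother, without invertibility -/

section NormalEquations

variable {n s : ℕ} {K : Matrix (Fin n) (Fin n) ℝ} {S : Matrix (Fin s) (Fin n) ℝ} {lam : ℝ}

lemma normalMatrix_transpose (hK : Kᵀ = K) :
    (normalMatrix K S lam)ᵀ = normalMatrix K S lam := by
  simp [normalMatrix, Matrix.transpose_mul, hK, Matrix.mul_assoc]

lemma normalMatrix_isHermitian (hK : Kᵀ = K) : (normalMatrix K S lam).IsHermitian := by
  simpa [Matrix.IsHermitian] using normalMatrix_transpose (S := S) (lam := lam) hK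

lemma dotProduct_normalMatrix (hK : Kᵀ = K) (β : Fin s → ℝ) :
    β ⬝ᵥ (normalMatrix K S lam *ᵥ β) =
      (K *ᵥ (Sᵀ *ᵥ β)) ⬝ᵥ (K *ᵥ (Sᵀ *ᵥ β)) + lam * ((Sᵀ *ᵥ β) ⬝ᵥ (K *ᵥ (Sᵀ *ᵥ β))) := by
  have h1 : ∀ v : Fin n → ℝ, β ⬝ᵥ (S *ᵥ v) = (Sᵀ *ᵥ β) ⬝ᵥ v := fun v => by
    rw [Matrix.dotProduct_mulVec, Matrix.mulVec_transpose]
  have h2 : ∀ u v : Fin n → ℝ, u ⬝ᵥ (K *ᵥ v) = (K *ᵥ u) ⬝ᵥ v := fun u v => by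
    rw [Matrix.dotProduct_mulVec, ← Matrix.mulVec_transpose, hK]
  simp only [normalMatrix, Matrix.add_mulVec, Matrix.smul_mulVec, dotProduct_add,
    dotProduct_smul, smul_eq_mul, ← Matrix.mulVec_mulVec, h1]
  rw [h2 _ (K *ᵥ (Sᵀ *ᵥ β))]

lemma dotProduct_normalMatrix_nonneg (hK : Kᵀ = K) (hp : ∀ v, 0 ≤ v ⬝ᵥ (K *ᵥ v))
    (hl : 0 ≤ lam) (β : Fin s → ℝ) : 0 ≤ β ⬝ᵥ (normalMatrix K S lam *ᵥ β) := by
  rw [dotProduct_normalMatrix hK]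
  exact add_nonneg (Finset.sum_nonneg fun i _ => mul_self_nonneg _) (mul_nonneg hl (hp _))

/-- The form is ‖K Sᵀβ‖² plus a nonnegative penalty. Hence null directions of the normal matrix do
not affect the fit. -/
lemma mulVec_eq_zero_of_normalMatrix (hK : Kᵀ = K) (hp : ∀ v, 0 ≤ v ⬝ᵥ (K *ᵥ v))
    (hl : 0 ≤ lam) {β : Fin s → ℝ} (h : β ⬝ᵥ (normalMatrix K S lam *ᵥ β) ≤ 0) :
    K *ᵥ (Sᵀ *ᵥ β) = 0 := by
  rw [dotProduct_normalMatrix hK] at h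
  have h1 := mul_nonneg hl (hp (Sᵀ *ᵥ β))
  have h2 : 0 ≤ (K *ᵥ (Sᵀ *ᵥ β)) ⬝ᵥ (K *ᵥ (Sᵀ *ᵥ β)) :=
    Finset.sum_nonneg fun i _ => mul_self_nonneg _
  exact dotProduct_self_eq_zero.1 (le_antisymm (by linarith) h2)

/-- For M the normal matrix, 1 − M⁺M maps into ker M, which K Sᵀ annihilates; transposing gives the
claim. It makes the normal equations solvable when M is singular. -/
lemma normalMatrix_mul_symmPinv_mul (hK : Kᵀ = K) (hp : ∀ v, 0 ≤ v ⬝ᵥ (K *ᵥ v))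
    (hl : 0 ≤ lam) :
    normalMatrix K S lam * symmPinv (normalMatrix K S lam) * (S * K) = S * K := by
  set M := normalMatrix K S lam with hM
  have hMt : Mᵀ = M := normalMatrix_transpose hK
  have h0 : M * (1 - symmPinv M * M) = 0 := by
    rw [mul_sub, mul_one, ← Matrix.mul_assoc, mul_symmPinv_mul (normalMatrix_isHermitian hK),
      sub_self]
  have h1 : K * Sᵀ * (1 - symmPinv M * M) = 0 := by
    refine Matrix.ext_of_mulVec_single fun j => ?_
    rw [← Matrix.mulVec_mulVec, ← Matrix.mulVec_mulVec, Matrix.zero_mulVec]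
    refine mulVec_eq_zero_of_normalMatrix (lam := lam) hK hp hl ?_
    rw [← hM, Matrix.mulVec_mulVec _ M, h0, Matrix.zero_mulVec, dotProduct_zero]
  have h2 := congrArg Matrix.transpose h1
  simp only [Matrix.transpose_mul, Matrix.transpose_sub, Matrix.transpose_one, hMt, hK,
    symmPinv_transpose, Matrix.transpose_transpose, Matrix.transpose_zero] at h2
  rw [Matrix.sub_mul, Matrix.one_mul] at h2
  exact (sub_eq_zero.1 h2).symm

/-- The coefficient vector `(S K² Sᵀ + λ S K Sᵀ)⁺ S K v` of the fit to `v`. -/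
noncomputable def sketchCoeff (K : Matrix (Fin n) (Fin n) ℝ) (S : Matrix (Fin s) (Fin n) ℝ) (lam : ℝ)
    (v : Fin n → ℝ) : Fin s → ℝ :=
  symmPinv (normalMatrix K S lam) *ᵥ ((S * K) *ᵥ v)

lemma smoother_mulVec (v : Fin n → ℝ) :
    smoother K S lam *ᵥ v = K *ᵥ (Sᵀ *ᵥ sketchCoeff K S lam v) := by
  simp [smoother, sketchCoeff, normalMatrix, Matrix.mulVec_mulVec, Matrix.mul_assoc]

lemma smoother_transpose (hK : Kᵀ = K) : (smoother K S lam)ᵀ = smoother K S lam := by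
  simp [smoother, Matrix.transpose_mul, hK, symmPinv_transpose, Matrix.mul_assoc]

lemma normalMatrix_mulVec_sketchCoeff (hK : Kᵀ = K) (hp : ∀ v, 0 ≤ v ⬝ᵥ (K *ᵥ v))
    (hl : 0 ≤ lam) (v : Fin n → ℝ) :
    normalMatrix K S lam *ᵥ sketchCoeff K S lam v = (S * K) *ᵥ v := by
  rw [sketchCoeff, Matrix.mulVec_mulVec, Matrix.mulVec_mulVec,
    normalMatrix_mul_symmPinv_mul hK hp hl]

lemma dotProduct_mul_mulVec (hK : Kᵀ = K) (β : Fin s → ℝ) (v : Fin n → ℝ) :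
    β ⬝ᵥ ((S * K) *ᵥ v) = v ⬝ᵥ (K *ᵥ (Sᵀ *ᵥ β)) := by
  rw [Matrix.dotProduct_mulVec, ← Matrix.mulVec_transpose, dotProduct_comm]
  simp [hK, Matrix.mulVec_mulVec]

/-- Completing the square in the sketched least squares problem. -/
lemma complete_square (hK : Kᵀ = K) (hp : ∀ v, 0 ≤ v ⬝ᵥ (K *ᵥ v))
    (hl : 0 ≤ lam) (v : Fin n → ℝ) (β : Fin s → ℝ) :
    β ⬝ᵥ (normalMatrix K S lam *ᵥ β) - 2 * (β ⬝ᵥ ((S * K) *ᵥ v)) =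
      (β - sketchCoeff K S lam v) ⬝ᵥ (normalMatrix K S lam *ᵥ (β - sketchCoeff K S lam v))
        - v ⬝ᵥ (smoother K S lam *ᵥ v) := by
  have h1 := normalMatrix_mulVec_sketchCoeff (S := S) hK hp hl v
  have h2 : sketchCoeff K S lam v ⬝ᵥ (normalMatrix K S lam *ᵥ β) = β ⬝ᵥ ((S * K) *ᵥ v) := by
    rw [Matrix.dotProduct_mulVec, ← Matrix.mulVec_transpose, normalMatrix_transpose hK, h1,
      dotProduct_comm]
  rw [smoother_mulVec, ← dotProduct_mul_mulVec hK, Matrix.mulVec_sub, dotProduct_sub,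
    sub_dotProduct, sub_dotProduct, h1, h2]
  ring

/-- The variational lower bound for the quadratic form of the smoother. -/
lemma le_dotProduct_smoother (hK : Kᵀ = K) (hp : ∀ v, 0 ≤ v ⬝ᵥ (K *ᵥ v))
    (hl : 0 ≤ lam) (v : Fin n → ℝ) (β : Fin s → ℝ) :
    2 * (v ⬝ᵥ (K *ᵥ (Sᵀ *ᵥ β))) - ((K *ᵥ (Sᵀ *ᵥ β)) ⬝ᵥ (K *ᵥ (Sᵀ *ᵥ β))
      + lam * ((Sᵀ *ᵥ β) ⬝ᵥ (K *ᵥ (Sᵀ *ᵥ β)))) ≤ v ⬝ᵥ (smoother K S lam *ᵥ v) := by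
  have h := complete_square (S := S) hK hp hl v β
  have h1 := dotProduct_normalMatrix_nonneg (S := S) hK hp hl (β - sketchCoeff K S lam v)
  rw [dotProduct_normalMatrix hK β, dotProduct_mul_mulVec hK] at h
  linarith

/-- At β = `sketchCoeff` the form of the normal matrix equals vᵀΔv; dropping its penalty term leaves
‖Δv‖². In operator terms, Δ² ≤ Δ. -/
lemma smoother_mulVec_dotProduct_self_le (hK : Kᵀ = K) (hp : ∀ v, 0 ≤ v ⬝ᵥ (K *ᵥ v))
    (hl : 0 ≤ lam) (v : Fin n → ℝ) :
    (smoother K S lam *ᵥ v) ⬝ᵥ (smoother K S lam *ᵥ v) ≤ v ⬝ᵥ (smoother K S lam *ᵥ v) := by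
  have h := complete_square (S := S) hK hp hl v (sketchCoeff K S lam v)
  rw [dotProduct_normalMatrix hK (sketchCoeff K S lam v), dotProduct_mul_mulVec hK, sub_self,
    zero_dotProduct, ← smoother_mulVec] at h
  have h1 := mul_nonneg hl (hp (Sᵀ *ᵥ sketchCoeff K S lam v))
  rw [← smoother_mulVec] at h1
  linarith

lemma dotProduct_self_sub {ι : Type*} [Fintype ι] (u v : ι → ℝ) :
    (u - v) ⬝ᵥ (u - v) = u ⬝ᵥ u - 2 * (u ⬝ᵥ v) + v ⬝ᵥ v := by
  rw [dotProduct_sub, sub_dotProduct, sub_dotProduct, dotProduct_comm v u]; ring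

lemma smoother_contraction (hK : Kᵀ = K) (hp : ∀ v, 0 ≤ v ⬝ᵥ (K *ᵥ v))
    (hl : 0 ≤ lam) (v : Fin n → ℝ) :
    (smoother K S lam *ᵥ v) ⬝ᵥ (smoother K S lam *ᵥ v) ≤ v ⬝ᵥ v := by
  have h := smoother_mulVec_dotProduct_self_le (S := S) hK hp hl v
  have h1 : 0 ≤ (v - smoother K S lam *ᵥ v) ⬝ᵥ (v - smoother K S lam *ᵥ v) :=
    Finset.sum_nonneg fun i _ => mul_self_nonneg _
  rw [dotProduct_self_sub] at h1
  linarith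

/-- The bias of the sketched estimator is bounded by the sketched objective at any candidate. -/
lemma bias_le (hK : Kᵀ = K) (hp : ∀ v, 0 ≤ v ⬝ᵥ (K *ᵥ v))
    (hl : 0 ≤ lam) (v : Fin n → ℝ) (β : Fin s → ℝ) :
    (v - smoother K S lam *ᵥ v) ⬝ᵥ (v - smoother K S lam *ᵥ v) ≤
      (v - K *ᵥ (Sᵀ *ᵥ β)) ⬝ᵥ (v - K *ᵥ (Sᵀ *ᵥ β))
        + lam * ((Sᵀ *ᵥ β) ⬝ᵥ (K *ᵥ (Sᵀ *ᵥ β))) := by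
  have h1 := smoother_mulVec_dotProduct_self_le (S := S) hK hp hl v
  have h2 := le_dotProduct_smoother (S := S) hK hp hl v β
  rw [dotProduct_self_sub, dotProduct_self_sub]
  linarith

lemma sketchObjective_eq (y : Fin n → ℝ) (β : Fin s → ℝ) :
    sketchObjective K S lam y β =
      β ⬝ᵥ (normalMatrix K S lam *ᵥ β) - 2 * (β ⬝ᵥ ((S * K) *ᵥ ((n : ℝ)⁻¹ • y))) := by
  simp only [sketchObjective, normalMatrix, Matrix.mulVec_smul, dotProduct_smul, smul_eq_mul,
    Matrix.add_mulVec, Matrix.smul_mulVec, dotProduct_add, Matrix.mul_assoc]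
  ring

/-- A minimizer need not be unique, but two of them differ by a vector on which the form of the
normal matrix vanishes, so the fit is unique. -/
lemma mulVec_minimizer (hK : Kᵀ = K) (hp : ∀ v, 0 ≤ v ⬝ᵥ (K *ᵥ v))
    (hl : 0 ≤ lam) (y : Fin n → ℝ) (β : Fin s → ℝ)
    (hβ : ∀ β', sketchObjective K S lam y β ≤ sketchObjective K S lam y β') :
    K *ᵥ (Sᵀ *ᵥ β) = (n : ℝ)⁻¹ • (smoother K S lam *ᵥ y) := by
  set v := (n : ℝ)⁻¹ • y with hv
  have h := hβ (sketchCoeff K S lam v)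
  rw [sketchObjective_eq, sketchObjective_eq, ← hv, complete_square hK hp hl v,
    complete_square hK hp hl v, sub_self, zero_dotProduct] at h
  have h1 := mulVec_eq_zero_of_normalMatrix (S := S) (lam := lam) hK hp hl
    (β := β - sketchCoeff K S lam v) (by linarith)
  rw [Matrix.mulVec_sub, Matrix.mulVec_sub, sub_eq_zero, ← smoother_mulVec, hv,
    Matrix.mulVec_smul] at h1
  exact h1

/-- The fitted values of the sketched estimator are `Δ y`. -/
lemma IsSketchedKRR.fitted {X : Type*} {k : X → X → ℝ} {x : Fin n → X} {y : Fin n → ℝ}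
    {f : X → ℝ} (h : IsSketchedKRR k x S lam y f) (hn : n ≠ 0)
    (hK : (kernelMatrix k x)ᵀ = kernelMatrix k x)
    (hp : ∀ v, 0 ≤ v ⬝ᵥ (kernelMatrix k x *ᵥ v)) (hl : 0 ≤ lam) (i : Fin n) :
    f (x i) = (smoother (kernelMatrix k x) S lam *ᵥ y) i := by
  obtain ⟨β, hβ, hf⟩ := h
  have hn' : (n : ℝ) ≠ 0 := by exact_mod_cast hn
  have h1 := congrFun (mulVec_minimizer hK hp hl y β hβ) i
  -- The estimator is built from k and the matrix K carries n⁻¹, so this n cancels the n⁻¹ in front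
  -- of y.
  rw [Pi.smul_apply, smul_eq_mul, eq_inv_mul_iff_mul_eq₀ hn'] at h1
  rw [← h1, hf]
  generalize Sᵀ *ᵥ β = h
  simp only [Matrix.mulVec, dotProduct, kernelMatrix, Matrix.of_apply, Finset.mul_sum]
  refine Finset.sum_congr rfl fun j _ => ?_
  field_simp

end NormalEquations

/-! ### Elementary Euclidean estimates -/

lemma dotProduct_self_eq_sum_sq {ι : Type*} [Fintype ι] (v : ι → ℝ) :
    v ⬝ᵥ v = ∑ i, v i ^ 2 := by
  simp [dotProduct, sq]

lemma dotProduct_self_nonneg {ι : Type*} [Fintype ι] (v : ι → ℝ) : 0 ≤ v ⬝ᵥ v :=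
  Finset.sum_nonneg fun _ _ => mul_self_nonneg _

/-- Expand ‖2a − b‖² ≥ 0 and use the hypothesis to eliminate ‖b‖². With a = Gb and ‖G − 1‖ ≤ 1/2 it
bounds bᵀGb by 2‖Gb‖². -/
lemma dotProduct_le_of_close {ι : Type*} [Fintype ι] {a b : ι → ℝ}
    (h : (a - b) ⬝ᵥ (a - b) ≤ 1 / 4 * (b ⬝ᵥ b)) : a ⬝ᵥ b ≤ 2 * (a ⬝ᵥ a) := by
  have h1 := dotProduct_self_nonneg ((2 : ℝ) • a - b)
  rw [dotProduct_self_sub] at h h1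
  simp only [smul_dotProduct, dotProduct_smul, smul_eq_mul] at h1
  linarith

open scoped Matrix.Norms.L2Operator in
lemma mulVec_dotProduct_self_le {ι κ : Type*} [Fintype ι] [Fintype κ] [DecidableEq ι]
    [DecidableEq κ] {A : Matrix ι κ ℝ} {C : ℝ} (h : ‖A‖ ≤ C) (v : κ → ℝ) :
    (A *ᵥ v) ⬝ᵥ (A *ᵥ v) ≤ C ^ 2 * (v ⬝ᵥ v) := by
  have h1 := Matrix.l2_opNorm_mulVec A (WithLp.toLp 2 v)
  have h2 := h1.trans (mul_le_mul_of_nonneg_right h (norm_nonneg _))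
  have h3 := pow_le_pow_left₀ (norm_nonneg _) h2 2
  rw [mul_pow, EuclideanSpace.real_norm_sq_eq, EuclideanSpace.real_norm_sq_eq] at h3
  simpa [dotProduct_self_eq_sum_sq] using h3

/-! ### Eigencoordinates, satisfiable sketches, bias and trace bounds -/

section Spectral

variable {n s : ℕ} {K : Matrix (Fin n) (Fin n) ℝ} {S : Matrix (Fin s) (Fin n) ℝ} {lam c : ℝ}

/-- The coordinates of a vector in the eigenbasis of `K`. -/
noncomputable def eigCoord (hK : K.IsHermitian) (v : Fin n → ℝ) : Fin n → ℝ :=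
  (hK.eigenvectorUnitary : Matrix (Fin n) (Fin n) ℝ)ᵀ *ᵥ v

lemma eigenvectorUnitary_transpose_mul (hK : K.IsHermitian) :
    (hK.eigenvectorUnitary : Matrix (Fin n) (Fin n) ℝ)ᵀ * hK.eigenvectorUnitary = 1 := by
  have h := Unitary.coe_star_mul_self hK.eigenvectorUnitary
  simpa [Matrix.star_eq_conjTranspose] using h

lemma eigenvectorUnitary_mul_transpose (hK : K.IsHermitian) :
    (hK.eigenvectorUnitary : Matrix (Fin n) (Fin n) ℝ) *
      (hK.eigenvectorUnitary : Matrix (Fin n) (Fin n) ℝ)ᵀ = 1 :=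
  mul_eq_one_comm.1 (eigenvectorUnitary_transpose_mul hK)

lemma eigCoord_dotProduct (hK : K.IsHermitian) (v w : Fin n → ℝ) :
    eigCoord hK v ⬝ᵥ eigCoord hK w = v ⬝ᵥ w := by
  rw [eigCoord, eigCoord, Matrix.dotProduct_mulVec, Matrix.vecMul_transpose,
    Matrix.mulVec_mulVec, eigenvectorUnitary_mul_transpose, Matrix.one_mulVec]

lemma eigCoord_mulVec (hK : K.IsHermitian) (v : Fin n → ℝ) (j : Fin n) :
    eigCoord hK (K *ᵥ v) j = hK.eigenvalues j * eigCoord hK v j := by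
  have h := hK.spectral_theorem
  have h1 : (hK.eigenvectorUnitary : Matrix (Fin n) (Fin n) ℝ)ᵀ * K =
      Matrix.diagonal hK.eigenvalues * (hK.eigenvectorUnitary : Matrix (Fin n) (Fin n) ℝ)ᵀ := by
    nth_rw 2 [h]
    rw [Unitary.conjStarAlgAut_apply, Matrix.star_eq_conjTranspose,
      Matrix.conjTranspose_eq_transpose_of_trivial, ← Matrix.mul_assoc, ← Matrix.mul_assoc,
      eigenvectorUnitary_transpose_mul, Matrix.one_mul]
    rfl
  rw [eigCoord, Matrix.mulVec_mulVec, h1, ← Matrix.mulVec_mulVec, Matrix.mulVec_diagonal]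
  rfl

lemma eigCoord_sub (hK : K.IsHermitian) (v w : Fin n → ℝ) :
    eigCoord hK (v - w) = eigCoord hK v - eigCoord hK w := Matrix.mulVec_sub _ _ _

lemma eigCoord_mulVec_eigenvectorUnitary (hK : K.IsHermitian) (a : Fin n → ℝ) :
    eigCoord hK ((hK.eigenvectorUnitary : Matrix (Fin n) (Fin n) ℝ) *ᵥ a) = a := by
  rw [eigCoord, Matrix.mulVec_mulVec, eigenvectorUnitary_transpose_mul, Matrix.one_mulVec]

lemma eigenvalues_nonneg_of_form (hK : K.IsHermitian) (hp : ∀ v, 0 ≤ v ⬝ᵥ (K *ᵥ v)) (j : Fin n) :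
    0 ≤ hK.eigenvalues j := by
  have h := hp ((hK.eigenvectorUnitary : Matrix (Fin n) (Fin n) ℝ) *ᵥ Pi.single j 1)
  rw [← eigCoord_dotProduct hK, eigCoord_mulVec_eigenvectorUnitary, single_one_dotProduct,
    eigCoord_mulVec, eigCoord_mulVec_eigenvectorUnitary] at h
  simpa using h

lemma dotProduct_mulVec_eq_sum (hK : K.IsHermitian) (v : Fin n → ℝ) :
    v ⬝ᵥ (K *ᵥ v) = ∑ j, hK.eigenvalues j * eigCoord hK v j ^ 2 := by
  rw [← eigCoord_dotProduct hK, dotProduct]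
  refine Finset.sum_congr rfl fun j _ => ?_
  rw [eigCoord_mulVec]; ring

/-- The indices of the eigenvalues of `K` greater than `lam`. -/
noncomputable def topIdx (hK : K.IsHermitian) (lam : ℝ) : Finset (Fin n) :=
  Finset.univ.filter fun j => lam < hK.eigenvalues j

lemma mem_topIdx (hK : K.IsHermitian) {j : Fin n} :
    j ∈ topIdx hK lam ↔ lam < hK.eigenvalues j := by simp [topIdx]

open scoped Matrix.Norms.L2Operator in
/-- On a `K`-satisfiable sketch, prescribed top eigencoordinates can be attained by a vector in
the range of `Sᵀ` whose remaining part has small `K`-energy. -/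
lemma KSatisfiable.exists_coeff (h : KSatisfiable K S lam c) (hK : K.IsHermitian)
    (hp : ∀ v, 0 ≤ v ⬝ᵥ (K *ᵥ v)) (hl : 0 ≤ lam) (a : Fin n → ℝ) :
    ∃ β : Fin s → ℝ, (∀ j ∈ topIdx hK lam, eigCoord hK (Sᵀ *ᵥ β) j = a j) ∧
      ∑ j ∈ (topIdx hK lam)ᶜ, hK.eigenvalues j * eigCoord hK (Sᵀ *ᵥ β) j ^ 2 ≤
        2 * c ^ 2 * lam * ∑ j ∈ topIdx hK lam, a j ^ 2 := by
  obtain ⟨_, h1, h2⟩ := h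
  set U := (hK.eigenvectorUnitary : Matrix (Fin n) (Fin n) ℝ) with hU
  set U₁ : Matrix (Fin n) {i // lam < hK.eigenvalues i} ℝ := U.submatrix id Subtype.val with hU₁
  set U₂ : Matrix (Fin n) {i // ¬ lam < hK.eigenvalues i} ℝ := U.submatrix id Subtype.val with hU₂
  set Q : Matrix {i // ¬ lam < hK.eigenvalues i} {i // ¬ lam < hK.eigenvalues i} ℝ :=
    Matrix.diagonal fun i => √(hK.eigenvalues i.1) with hQ
  set G := (S * U₁)ᵀ * (S * U₁) with hG
  have hG1 : ∀ b, (G *ᵥ b - b) ⬝ᵥ (G *ᵥ b - b) ≤ 1 / 4 * (b ⬝ᵥ b) := fun b => by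
    have := mulVec_dotProduct_self_le h1 b
    rw [Matrix.sub_mulVec, Matrix.one_mulVec] at this
    norm_num at this ⊢
    exact this
  have hGu : IsUnit G := by
    rw [← Matrix.mulVec_injective_iff_isUnit]
    refine (injective_iff_map_eq_zero (Matrix.mulVecLin G)).2 fun b hb => ?_
    have hb' : G *ᵥ b = 0 := hb
    have := hG1 b
    rw [hb', zero_sub, neg_dotProduct, dotProduct_neg, neg_neg] at this
    exact dotProduct_self_eq_zero.1 (le_antisymm (by linarith) (dotProduct_self_nonneg b))
  set a' : {i // lam < hK.eigenvalues i} → ℝ := fun i => a i with ha'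
  -- The witness is β = S U₁ G⁻¹ a': the top coordinates of Sᵀβ are then U₁ᵀSᵀS U₁ b = G b = a'.
  set b := G⁻¹ *ᵥ a' with hb
  have hGb : G *ᵥ b = a' := by
    rw [hb, Matrix.mulVec_mulVec, Matrix.mul_nonsing_inv _ ((Matrix.isUnit_iff_isUnit_det _).1 hGu),
      Matrix.one_mulVec]
  have hββ : ((S * U₁) *ᵥ b) ⬝ᵥ ((S * U₁) *ᵥ b) ≤ 2 * (a' ⬝ᵥ a') := by
    have h3 : ((S * U₁) *ᵥ b) ⬝ᵥ ((S * U₁) *ᵥ b) = a' ⬝ᵥ b := by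
      rw [Matrix.dotProduct_mulVec, ← Matrix.mulVec_transpose, Matrix.mulVec_mulVec, ← hG, hGb]
    rw [h3]
    have := hG1 b
    rw [hGb] at this
    exact dotProduct_le_of_close this
  refine ⟨(S * U₁) *ᵥ b, fun j hj => ?_, ?_⟩
  · rw [mem_topIdx] at hj
    have h4 := congrFun hGb ⟨j, hj⟩
    rw [hG, ← Matrix.mulVec_mulVec, Matrix.transpose_mul, ← Matrix.mulVec_mulVec] at h4
    exact h4
  · have h5 : ‖(S * U₂ * Q)ᵀ‖ ≤ c * √lam := by
      rw [← Matrix.conjTranspose_eq_transpose_of_trivial, Matrix.l2_opNorm_conjTranspose]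
      exact h2
    have h6 := mulVec_dotProduct_self_le h5 ((S * U₁) *ᵥ b)
    have h7 : ((S * U₂ * Q)ᵀ *ᵥ ((S * U₁) *ᵥ b)) ⬝ᵥ ((S * U₂ * Q)ᵀ *ᵥ ((S * U₁) *ᵥ b)) =
        ∑ j ∈ (topIdx hK lam)ᶜ,
          hK.eigenvalues j * eigCoord hK (Sᵀ *ᵥ ((S * U₁) *ᵥ b)) j ^ 2 := by
      rw [Finset.sum_subtype (p := fun j => ¬ lam < hK.eigenvalues j) _
        (fun j => by simp [mem_topIdx]), dotProduct_self_eq_sum_sq]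
      refine Finset.sum_congr rfl fun j _ => ?_
      rw [Matrix.transpose_mul, Matrix.transpose_mul, ← Matrix.mulVec_mulVec,
        ← Matrix.mulVec_mulVec, hQ, Matrix.diagonal_transpose, Matrix.mulVec_diagonal, mul_pow,
        Real.sq_sqrt (eigenvalues_nonneg_of_form hK hp _)]
      rfl
    have h8 : a' ⬝ᵥ a' = ∑ j ∈ topIdx hK lam, a j ^ 2 := by
      rw [Finset.sum_subtype (p := fun j => lam < hK.eigenvalues j) _
        (fun j => by simp [mem_topIdx]), dotProduct_self_eq_sum_sq]
    rw [h7, mul_pow, Real.sq_sqrt hl] at h6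
    rw [h8] at hββ
    refine h6.trans ((mul_le_mul_of_nonneg_left hββ (by positivity)).trans (le_of_eq (by ring)))

/-- Energy estimates for a vector with the two properties of `KSatisfiable.exists_coeff`. -/
lemma dotProduct_mulVec_le_of_coeff (hK : K.IsHermitian) {a h : Fin n → ℝ} {B : ℝ}
    (h1 : ∀ j ∈ topIdx hK lam, eigCoord hK h j = a j)
    (h2 : ∑ j ∈ (topIdx hK lam)ᶜ, hK.eigenvalues j * eigCoord hK h j ^ 2 ≤ B) :
    h ⬝ᵥ (K *ᵥ h) ≤ ∑ j ∈ topIdx hK lam, hK.eigenvalues j * a j ^ 2 + B := by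
  rw [dotProduct_mulVec_eq_sum hK, ← Finset.sum_add_sum_compl (topIdx hK lam)]
  refine add_le_add (Finset.sum_le_sum fun j hj => ?_) h2
  rw [h1 j hj]

/-- Below the threshold D_j² ≤ λ D_j, which turns a bound on energy into one on the fit. -/
lemma sum_compl_eigenvalues_sq_le (hK : K.IsHermitian) (hp : ∀ v, 0 ≤ v ⬝ᵥ (K *ᵥ v))
    (hl : 0 ≤ lam) {h : Fin n → ℝ} {B : ℝ}
    (h2 : ∑ j ∈ (topIdx hK lam)ᶜ, hK.eigenvalues j * eigCoord hK h j ^ 2 ≤ B) :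
    ∑ j ∈ (topIdx hK lam)ᶜ, (hK.eigenvalues j * eigCoord hK h j) ^ 2 ≤ lam * B := by
  refine le_trans ?_ (mul_le_mul_of_nonneg_left h2 hl)
  rw [Finset.mul_sum]
  refine Finset.sum_le_sum fun j hj => ?_
  have hj' : hK.eigenvalues j ≤ lam := by
    simpa [mem_topIdx] using hj
  have h3 := eigenvalues_nonneg_of_form hK hp j
  rw [mul_pow, sq (hK.eigenvalues j), mul_assoc]
  exact mul_le_mul_of_nonneg_right hj' (mul_nonneg h3 (sq_nonneg _))

/-- The bias of the sketched estimator on a `K`-satisfiable sketch. -/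
lemma KSatisfiable.bias_le (h : KSatisfiable K S lam c) (hK : K.IsHermitian)
    (hp : ∀ v, 0 ≤ v ⬝ᵥ (K *ᵥ v)) (hl : 0 < lam) {f : Fin n → ℝ} {B : ℝ} (hB : 0 ≤ B)
    (hf : ∀ h, (f ⬝ᵥ h) ^ 2 ≤ B * (h ⬝ᵥ (K *ᵥ h))) :
    (f - smoother K S lam *ᵥ f) ⬝ᵥ (f - smoother K S lam *ᵥ f) ≤
      lam * (B * (3 + 6 * c ^ 2)) := by
  set D := hK.eigenvalues with hD
  set α := eigCoord hK f with hα
  set U := (hK.eigenvectorUnitary : Matrix (Fin n) (Fin n) ℝ) with hU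
  -- In eigencoordinates the hypothesis on f is a Cauchy–Schwarz inequality; suitable test vectors a
  -- turn it into x² ≤ b x, hence x ≤ b.
  have hcoord : ∀ a : Fin n → ℝ, (∑ j, α j * a j) ^ 2 ≤ B * ∑ j, D j * a j ^ 2 := fun a => by
    have := hf (U *ᵥ a)
    rwa [← eigCoord_dotProduct hK, dotProduct_mulVec_eq_sum hK,
      eigCoord_mulVec_eigenvectorUnitary] at this
  have hsq : ∀ x b : ℝ, 0 ≤ x → 0 ≤ b → x ^ 2 ≤ b * x → x ≤ b := fun x b hx hb hxb => by
    rcases hx.eq_or_lt with h0 | h0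
    · rw [← h0]; exact hb
    · rw [sq] at hxb; exact le_of_mul_le_mul_right hxb h0
  have hDtop : ∀ j ∈ topIdx hK lam, lam < D j := fun j hj => (mem_topIdx hK).1 hj
  have htop : ∑ j ∈ topIdx hK lam, α j ^ 2 / D j ≤ B := by
    refine hsq _ _ (Finset.sum_nonneg fun j hj =>
      div_nonneg (sq_nonneg _) (hl.trans (hDtop j hj)).le) hB ?_
    have := hcoord fun j => if j ∈ topIdx hK lam then α j / D j else 0
    simp only [mul_ite, mul_zero, ite_pow, ne_eq, OfNat.ofNat_ne_zero, not_false_eq_true,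
      zero_pow, Finset.sum_ite_mem, Finset.univ_inter] at this
    have hA : ∑ j ∈ topIdx hK lam, α j * (α j / D j) = ∑ j ∈ topIdx hK lam, α j ^ 2 / D j :=
      Finset.sum_congr rfl fun j _ => by ring
    have hA' : ∑ j ∈ topIdx hK lam, D j * (α j / D j) ^ 2 = ∑ j ∈ topIdx hK lam, α j ^ 2 / D j :=
      Finset.sum_congr rfl fun j hj => by
        have := (hl.trans (hDtop j hj)).ne'
        field_simp
    rwa [hA, hA'] at this
  have hlow : ∑ j ∈ (topIdx hK lam)ᶜ, α j ^ 2 ≤ B * lam := by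
    refine hsq _ _ (Finset.sum_nonneg fun j hj => sq_nonneg _) (by positivity) ?_
    have := hcoord fun j => if j ∈ (topIdx hK lam)ᶜ then α j else 0
    simp only [mul_ite, mul_zero, ite_pow, ne_eq, OfNat.ofNat_ne_zero, not_false_eq_true,
      zero_pow, Finset.sum_ite_mem, Finset.univ_inter] at this
    simp only [← sq] at this
    refine this.trans ?_
    rw [mul_assoc]
    refine mul_le_mul_of_nonneg_left ?_ hB
    rw [Finset.mul_sum]
    refine Finset.sum_le_sum fun j hj => ?_
    have hj' : D j ≤ lam := by simpa [mem_topIdx] using hj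
    exact mul_le_mul_of_nonneg_right hj' (sq_nonneg _)
  -- With coordinates α_j / D_j the fit K Sᵀβ reproduces f exactly in the top directions.
  obtain ⟨β, h1, h2⟩ := h.exists_coeff hK hp hl.le fun j => α j / D j
  have h3 : 2 * c ^ 2 * lam * ∑ j ∈ topIdx hK lam, (α j / D j) ^ 2 ≤ 2 * c ^ 2 * B := by
    rw [mul_assoc]
    refine mul_le_mul_of_nonneg_left (le_trans ?_ htop) (by positivity)
    rw [Finset.mul_sum]
    refine Finset.sum_le_sum fun j hj => ?_
    have h4 := hDtop j hj
    have h5 := hl.trans h4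
    rw [div_pow, sq (D j), mul_div_assoc', div_le_div_iff₀ (by positivity) h5]
    nlinarith [mul_nonneg (mul_nonneg (sq_nonneg (α j)) h5.le) (sub_nonneg.2 h4.le)]
  replace h2 := h2.trans h3
  have h6 := dotProduct_mulVec_le_of_coeff hK h1 h2
  have h7 : ∑ j ∈ topIdx hK lam, D j * (α j / D j) ^ 2 ≤ B := by
    refine le_trans (le_of_eq (Finset.sum_congr rfl fun j hj => ?_)) htop
    have := (hl.trans (hDtop j hj)).ne'
    field_simp
  have h8 := sum_compl_eigenvalues_sq_le hK hp hl.le h2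
  have h9 : (f - K *ᵥ (Sᵀ *ᵥ β)) ⬝ᵥ (f - K *ᵥ (Sᵀ *ᵥ β)) ≤
      2 * (B * lam) + 2 * (lam * (2 * c ^ 2 * B)) := by
    rw [← eigCoord_dotProduct hK, dotProduct_self_eq_sum_sq,
      ← Finset.sum_add_sum_compl (topIdx hK lam)]
    have h10 : ∑ j ∈ topIdx hK lam, eigCoord hK (f - K *ᵥ (Sᵀ *ᵥ β)) j ^ 2 = 0 := by
      refine Finset.sum_eq_zero fun j hj => ?_
      have := (hl.trans (hDtop j hj)).ne'
      rw [eigCoord_sub, Pi.sub_apply, eigCoord_mulVec, h1 j hj, ← hD, ← hα]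
      field_simp
      simp
    rw [h10, zero_add]
    refine le_trans ?_ (add_le_add (mul_le_mul_of_nonneg_left hlow zero_le_two)
      (mul_le_mul_of_nonneg_left h8 zero_le_two))
    rw [Finset.mul_sum, Finset.mul_sum, ← Finset.sum_add_distrib]
    refine Finset.sum_le_sum fun j _ => ?_
    rw [eigCoord_sub, Pi.sub_apply, eigCoord_mulVec]
    nlinarith [sq_nonneg (eigCoord hK f j + hK.eigenvalues j * eigCoord hK (Sᵀ *ᵥ β) j)]
  have hKt : Kᵀ = K := by simpa [Matrix.IsHermitian] using hK
  refine (SketchedKRR.bias_le hKt hp hl.le f β).trans ?_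
  -- The fit costs 2 + 4c² and the penalty 1 + 2c², each times λB, which gives the factor 3 + 6c².
  have h11 := mul_le_mul_of_nonneg_left (h6.trans (add_le_add_left h7 _)) hl.le
  linarith

/-- On a `K`-satisfiable sketch, `tr(Δ²)` is at least of the order of the number of eigenvalues
of `K` greater than `lam`. -/
lemma KSatisfiable.card_topIdx_le (h : KSatisfiable K S lam c) (hK : K.IsHermitian)
    (hp : ∀ v, 0 ≤ v ⬝ᵥ (K *ᵥ v)) (hl : 0 < lam) :
    ((topIdx hK lam).card : ℝ) * (1 / (2 + 4 * c ^ 2)) ^ 2 ≤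
      (smoother K S lam * smoother K S lam).trace := by
  have hKt : Kᵀ = K := by simpa [Matrix.IsHermitian] using hK
  set U := (hK.eigenvectorUnitary : Matrix (Fin n) (Fin n) ℝ) with hU
  set Δ := smoother K S lam with hΔ
  have hΔt : Δᵀ = Δ := smoother_transpose hKt
  set u : Fin n → Fin n → ℝ := fun j => U *ᵥ Pi.single j 1 with hu
  have htr : (Δ * Δ).trace = ∑ j, (Δ *ᵥ u j) ⬝ᵥ (Δ *ᵥ u j) := by
    have h1 : (Δ * Δ).trace = ((Δ * U)ᵀ * (Δ * U)).trace := by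
      rw [Matrix.transpose_mul, hΔt, Matrix.trace_mul_comm (Uᵀ * Δ), Matrix.mul_assoc,
        ← Matrix.mul_assoc U, eigenvectorUnitary_mul_transpose hK, Matrix.one_mul]
    rw [h1, Matrix.trace]
    refine Finset.sum_congr rfl fun j _ => ?_
    simp only [hu, Matrix.mulVec_single_one]
    rfl
  have huu : ∀ j, u j ⬝ᵥ u j = 1 := fun j => by
    rw [← eigCoord_dotProduct hK, eigCoord_mulVec_eigenvectorUnitary]; simp
  -- The candidate below gives the lower bound 2t − (2 + 4c²)t² for uᵀΔu; this t maximizes it, with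
  -- value t.
  set t : ℝ := 1 / (2 + 4 * c ^ 2) with ht
  have ht0 : 0 < 2 + 4 * c ^ 2 := by positivity
  have hge : ∀ j ∈ topIdx hK lam, t ≤ u j ⬝ᵥ (Δ *ᵥ u j) := by
    intro j hj
    have hDj : lam < hK.eigenvalues j := (mem_topIdx hK).1 hj
    have hDj0 := hl.trans hDj
    obtain ⟨β, h1, h2⟩ := h.exists_coeff hK hp hl.le (Pi.single j (t / hK.eigenvalues j))
    have hs : ∀ w : Fin n → ℝ, ∑ i ∈ topIdx hK lam,
        w i * (Pi.single j (t / hK.eigenvalues j) : Fin n → ℝ) i ^ 2 =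
          w j * (t / hK.eigenvalues j) ^ 2 := fun w => by
      rw [Finset.sum_eq_single_of_mem j hj (fun i _ hi => by simp [Pi.single_eq_of_ne hi])]
      simp
    have h3 : 2 * c ^ 2 * lam * ∑ i ∈ topIdx hK lam,
        (Pi.single j (t / hK.eigenvalues j) : Fin n → ℝ) i ^ 2 ≤ 2 * c ^ 2 * t ^ 2 / lam := by
      have := hs fun _ => 1
      simp only [one_mul] at this
      rw [this, mul_assoc, mul_div_assoc]
      refine mul_le_mul_of_nonneg_left ?_ (by positivity)
      rw [div_pow, mul_div_assoc', div_le_div_iff₀ (by positivity) hl]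
      have : lam ^ 2 ≤ hK.eigenvalues j ^ 2 := pow_le_pow_left₀ hl.le hDj.le 2
      nlinarith [mul_le_mul_of_nonneg_left this (sq_nonneg t)]
    replace h2 := h2.trans h3
    have h6 := dotProduct_mulVec_le_of_coeff hK h1 h2
    rw [hs] at h6
    have h8 := sum_compl_eigenvalues_sq_le hK hp hl.le h2
    have h9 : u j ⬝ᵥ (K *ᵥ (Sᵀ *ᵥ β)) = t := by
      rw [← eigCoord_dotProduct hK, eigCoord_mulVec_eigenvectorUnitary, single_one_dotProduct,
        eigCoord_mulVec, h1 j hj]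
      simp only [Pi.single_eq_same]
      field_simp
    have h10 : (K *ᵥ (Sᵀ *ᵥ β)) ⬝ᵥ (K *ᵥ (Sᵀ *ᵥ β)) ≤ t ^ 2 + 2 * c ^ 2 * t ^ 2 := by
      rw [← eigCoord_dotProduct hK, dotProduct_self_eq_sum_sq,
        ← Finset.sum_add_sum_compl (topIdx hK lam)]
      refine add_le_add (le_of_eq ?_) (le_trans (le_of_eq ?_) (h8.trans (le_of_eq ?_)))
      · trans hK.eigenvalues j ^ 2 * (t / hK.eigenvalues j) ^ 2
        · rw [← hs fun i => hK.eigenvalues i ^ 2]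
          refine Finset.sum_congr rfl fun i hi => ?_
          rw [eigCoord_mulVec, h1 i hi, mul_pow]
        · field_simp
      · exact Finset.sum_congr rfl fun i _ => by rw [eigCoord_mulVec]
      · field_simp
    have h11 : lam * ((Sᵀ *ᵥ β) ⬝ᵥ (K *ᵥ (Sᵀ *ᵥ β))) ≤ t ^ 2 + 2 * c ^ 2 * t ^ 2 := by
      refine (mul_le_mul_of_nonneg_left h6 hl.le).trans ?_
      rw [mul_add]
      refine add_le_add ?_ (le_of_eq (by field_simp))
      have : lam * (hK.eigenvalues j * (t / hK.eigenvalues j) ^ 2) =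
        lam / hK.eigenvalues j * t ^ 2 := by field_simp
      rw [this]
      exact mul_le_of_le_one_left (sq_nonneg _) ((div_le_one hDj0).2 hDj.le)
    have h12 := le_dotProduct_smoother (S := S) hKt hp hl.le (u j) β
    rw [h9] at h12
    have h13 : (2 + 4 * c ^ 2) * t ^ 2 = t := by rw [ht]; field_simp
    refine le_trans ?_ h12
    linarith
  have hterm : ∀ j ∈ topIdx hK lam, t ^ 2 ≤ (Δ *ᵥ u j) ⬝ᵥ (Δ *ᵥ u j) := by
    intro j hj
    have h1 := hge j hj
    have h2 := dotProduct_self_nonneg (Δ *ᵥ u j - t • u j)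
    -- From ‖Δu − tu‖² ≥ 0 and ‖u‖ = 1: ‖Δu‖² ≥ 2t uᵀΔu − t² ≥ t².
    rw [dotProduct_self_sub, dotProduct_smul, smul_dotProduct, dotProduct_smul, huu,
      dotProduct_comm (Δ *ᵥ u j) (u j)] at h2
    simp only [smul_eq_mul] at h2
    have ht1 : 0 < t := by positivity
    nlinarith
  rw [htr, ← nsmul_eq_mul]
  exact (Finset.card_nsmul_le_sum _ _ _ hterm).trans
    (Finset.sum_le_sum_of_subset_of_nonneg (Finset.subset_univ _)
      fun j _ _ => dotProduct_self_nonneg _)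

/-- If the quadratic form of `K` dominates `m ∑ⱼ (Φⱼ ⬝ v)²` for `k` nearly orthonormal vectors
`Φⱼ`, then `K` has at least `k` eigenvalues greater than any `lam < m / 2`. -/
lemma le_card_topIdx (hK : K.IsHermitian) {k : ℕ} (Φ : Fin k → Fin n → ℝ) {m : ℝ} (hm : 0 < m)
    (hdom : ∀ v, m * ∑ j, (Φ j ⬝ᵥ v) ^ 2 ≤ v ⬝ᵥ (K *ᵥ v))
    (hΦ : ∀ j l, |Φ j ⬝ᵥ Φ l - if j = l then 1 else 0| ≤ 1 / (2 * (k : ℝ))) (hlm : lam < m / 2) :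
    k ≤ (topIdx hK lam).card := by
  by_contra! hlt
  set N : Matrix (topIdx hK lam) (Fin k) ℝ := Matrix.of fun j l => eigCoord hK (Φ l) j with hN
  have hker : LinearMap.ker N.mulVecLin ≠ ⊥ := by
    refine LinearMap.ker_ne_bot_of_finrank_lt ?_
    simpa using hlt
  -- With fewer than k top eigenvectors, a nontrivial combination v of the Φⱼ is orthogonal to all
  -- of them, so vᵀKv ≤ lam ‖v‖². Domination contradicts this.
  obtain ⟨a, haN, ha0⟩ := Submodule.exists_mem_ne_zero_of_ne_bot hker
  set v : Fin n → ℝ := ∑ l, a l • Φ l with hv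
  set g : Fin k → ℝ := fun j => Φ j ⬝ᵥ v with hg
  have hk : 0 < k := by
    rcases Nat.eq_zero_or_pos k with h0 | h0
    · subst h0; exact absurd (Subsingleton.elim _ _) ha0
    · exact h0
  have hkr : (0 : ℝ) < k := by exact_mod_cast hk
  have hag : v ⬝ᵥ v = g ⬝ᵥ a := by
    nth_rw 1 [hv]
    rw [sum_dotProduct, dotProduct]
    refine Finset.sum_congr rfl fun l _ => ?_
    rw [smul_dotProduct, smul_eq_mul, mul_comm]
  -- The Gram error has k² entries of size at most 1/(2k), so its squared Frobenius norm is at most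
  -- 1/4.
  have hclose : (g - a) ⬝ᵥ (g - a) ≤ 1 / 4 * (a ⬝ᵥ a) := by
    have h1 : ∀ j, (g - a) j ^ 2 ≤ 1 / (4 * k) * ∑ l, a l ^ 2 := fun j => by
      have h2 : (g - a) j = ∑ l, (Φ j ⬝ᵥ Φ l - if j = l then 1 else 0) * a l := by
        simp only [Pi.sub_apply, hg, hv, dotProduct_sum, dotProduct_smul, smul_eq_mul, sub_mul,
          ite_mul, one_mul, zero_mul, Finset.sum_sub_distrib, Finset.sum_ite_eq,
          Finset.mem_univ, if_true, mul_comm (a _)]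
      rw [h2]
      refine (Finset.sum_mul_sq_le_sq_mul_sq _ _ _).trans
        (mul_le_mul_of_nonneg_right ?_ (Finset.sum_nonneg fun l _ => sq_nonneg _))
      have h3 : ∀ l ∈ Finset.univ, (Φ j ⬝ᵥ Φ l - if j = l then 1 else 0) ^ 2 ≤
          (1 / (2 * (k : ℝ))) ^ 2 := fun l _ => by
        rw [← sq_abs]; exact pow_le_pow_left₀ (abs_nonneg _) (hΦ j l) 2
      refine (Finset.sum_le_card_nsmul _ _ _ h3).trans (le_of_eq ?_)
      rw [Finset.card_univ, Fintype.card_fin, nsmul_eq_mul]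
      field_simp
      norm_num
    rw [dotProduct_self_eq_sum_sq, dotProduct_self_eq_sum_sq]
    refine (Finset.sum_le_card_nsmul _ _ _ fun j _ => h1 j).trans (le_of_eq ?_)
    rw [Finset.card_univ, Fintype.card_fin, nsmul_eq_mul]
    field_simp
  have h4 := dotProduct_le_of_close hclose
  have h5 : 0 < g ⬝ᵥ a := by
    have h6 := dotProduct_self_nonneg g
    have h7 : 0 < a ⬝ᵥ a := (dotProduct_self_nonneg a).lt_of_ne
      fun h => ha0 (dotProduct_self_eq_zero.1 h.symm)
    rw [dotProduct_self_sub] at hclose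
    linarith
  have h8 : v ⬝ᵥ (K *ᵥ v) ≤ lam * (v ⬝ᵥ v) := by
    rw [dotProduct_mulVec_eq_sum hK, ← eigCoord_dotProduct hK, dotProduct_self_eq_sum_sq,
      Finset.mul_sum]
    refine Finset.sum_le_sum fun j _ => ?_
    by_cases hj : j ∈ topIdx hK lam
    · have h9 : eigCoord hK v j = 0 := by
        have h10 : (N *ᵥ a) ⟨j, hj⟩ = 0 := congrFun (show N *ᵥ a = 0 from haN) _
        rw [← h10, hv, eigCoord, Matrix.mulVec_sum, Finset.sum_apply]
        simp only [Matrix.mulVec, dotProduct, hN, Matrix.of_apply]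
        refine Finset.sum_congr rfl fun l _ => ?_
        simp only [eigCoord, Matrix.mulVec, dotProduct, Pi.smul_apply, smul_eq_mul,
          Finset.sum_mul]
        exact Finset.sum_congr rfl fun i _ => by ring
      rw [h9]; simp
    · rw [mem_topIdx, not_lt] at hj
      exact mul_le_mul_of_nonneg_right hj (sq_nonneg _)
  have h11 := hdom v
  have h12 : ∑ j, (Φ j ⬝ᵥ v) ^ 2 = g ⬝ᵥ g := (dotProduct_self_eq_sum_sq g).symm
  rw [h12] at h11
  rw [hag] at h8
  -- With 0 < gᵀa ≤ 2‖g‖², m‖g‖² ≥ (m/2) gᵀa > lam gᵀa = lam ‖v‖².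
  nlinarith

end Spectral

/-! ### Measurability of the Moore–Penrose inverse and the smoother -/

lemma tendsto_div_sq_add_inv (t : ℝ) :
    Tendsto (fun k : ℕ => t / (t * t + 1 / ((k : ℝ) + 1))) atTop (𝓝 t⁻¹) := by
  rcases eq_or_ne t 0 with rfl | ht
  · simp
  · have h : Tendsto (fun k : ℕ => t * t + 1 / ((k : ℝ) + 1)) atTop (𝓝 (t * t + 0)) :=
      tendsto_const_nhds.add tendsto_one_div_add_atTop_nhds_zero_nat
    have h1 := (tendsto_const_nhds (x := t)).div h (by simpa using ht)
    have h2 : t / (t * t + 0) = t⁻¹ := by field_simp; simp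
    rwa [h2] at h1

/-- The Moore-Penrose inverse is the limit of Tikhonov regularized inverses. -/
lemma tendsto_regularized_inv {m : ℕ} {M : Matrix (Fin m) (Fin m) ℝ} (hM : M.IsHermitian) :
    Tendsto (fun k : ℕ => M * (M * M + (1 / ((k : ℝ) + 1)) • 1)⁻¹) atTop (𝓝 (symmPinv M)) := by
  have hsa : IsSelfAdjoint M := hM
  have h1 : ∀ k : ℕ, M * (M * M + (1 / ((k : ℝ) + 1)) • 1)⁻¹ =
      cfc (fun t : ℝ => t / (t * t + 1 / ((k : ℝ) + 1))) M := fun k => by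
    set δ : ℝ := 1 / ((k : ℝ) + 1) with hδ
    have hδ0 : 0 < δ := by positivity
    have hne : ∀ t : ℝ, t * t + δ ≠ 0 := fun t => by
      have := mul_self_nonneg t
      positivity
    have h2 : cfc (fun t : ℝ => t * t + δ) M = M * M + δ • 1 := by
      rw [cfc_add (a := M) (fun t : ℝ => t * t) (fun _ => δ) (continuousOn_spectrum M _)
        (continuousOn_spectrum M _), cfc_const δ M, cfc_mul (fun t : ℝ => t) (fun t : ℝ => t) M
        (continuousOn_spectrum M _) (continuousOn_spectrum M _), cfc_id' ℝ M,
        Algebra.algebraMap_eq_smul_one]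
    have h3 : (M * M + δ • 1) * cfc (fun t : ℝ => (t * t + δ)⁻¹) M = 1 := by
      rw [← h2, ← cfc_mul _ _ M (continuousOn_spectrum M _) (continuousOn_spectrum M _),
        cfc_congr (g := fun _ : ℝ => (1 : ℝ)) fun t _ => mul_inv_cancel₀ (hne t)]
      exact cfc_const_one ℝ M
    rw [Matrix.inv_eq_right_inv h3]
    nth_rw 1 [← cfc_id' ℝ M]
    rw [← cfc_mul _ _ M (continuousOn_spectrum M _) (continuousOn_spectrum M _)]
    rfl
  simp_rw [h1]
  rw [symmPinv]
  simp_rw [hM.cfc_eq, Matrix.IsHermitian.cfc, Unitary.conjStarAlgAut_apply]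
  refine Tendsto.mul (Tendsto.mul tendsto_const_nhds ?_) tendsto_const_nhds
  exact ((Continuous.matrix_diagonal continuous_id).tendsto _).comp
    (tendsto_pi_nhds.2 fun j => tendsto_div_sq_add_inv _)

section Measurability

variable {α : Type*} [MeasurableSpace α]

/-- Entrywise measurability of a matrix-valued map. -/
def MeasurableEntries {ι κ : Type*} (A : α → Matrix ι κ ℝ) : Prop :=
  ∀ i j, Measurable fun a => A a i j

namespace MeasurableEntries

variable {l m n : ℕ}

lemma mul {A : α → Matrix (Fin l) (Fin m) ℝ} {B : α → Matrix (Fin m) (Fin n) ℝ}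
    (hA : MeasurableEntries A) (hB : MeasurableEntries B) :
    MeasurableEntries fun a => A a * B a := fun i j => by
  simp only [Matrix.mul_apply]
  exact Finset.measurable_sum _ fun k _ => (hA i k).mul (hB k j)

lemma add {A B : α → Matrix (Fin l) (Fin m) ℝ}
    (hA : MeasurableEntries A) (hB : MeasurableEntries B) :
    MeasurableEntries fun a => A a + B a := fun i j => (hA i j).add (hB i j)

lemma smul (r : ℝ) {A : α → Matrix (Fin l) (Fin m) ℝ}
    (hA : MeasurableEntries A) : MeasurableEntries fun a => r • A a :=
  fun i j => (hA i j).const_mul r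

lemma transpose {A : α → Matrix (Fin l) (Fin m) ℝ}
    (hA : MeasurableEntries A) : MeasurableEntries fun a => (A a)ᵀ := fun i j => hA j i

lemma const (A : Matrix (Fin l) (Fin m) ℝ) : MeasurableEntries fun _ : α => A :=
  fun _ _ => measurable_const

lemma det {A : α → Matrix (Fin m) (Fin m) ℝ} (hA : MeasurableEntries A) :
    Measurable fun a => (A a).det := by
  simp only [Matrix.det_apply]
  exact Finset.measurable_sum _ fun σ _ =>
    (Finset.measurable_prod _ fun i _ => hA (σ i) i).const_smul (Equiv.Perm.sign σ)

/-- Cramer's rule gives entries rational in those of A; the convention 0⁻¹ = 0 covers singular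
matrices. -/
lemma inv {A : α → Matrix (Fin m) (Fin m) ℝ} (hA : MeasurableEntries A) :
    MeasurableEntries fun a => (A a)⁻¹ := fun i j => by
  simp only [Matrix.inv_def, Matrix.smul_apply, Ring.inverse_eq_inv', smul_eq_mul,
    Matrix.adjugate_apply]
  refine hA.det.inv.mul (det fun k l => ?_)
  by_cases hk : k = j
  · subst hk; simp
  · simpa [Matrix.updateRow_ne hk] using hA k l

/-- The Moore–Penrose inverse is discontinuous in the matrix, but it is a pointwise limit of
measurable regularized inverses. -/
lemma symmPinv {A : α → Matrix (Fin m) (Fin m) ℝ} (hA : MeasurableEntries A)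
    (hs : ∀ a, (A a).IsHermitian) : MeasurableEntries fun a => symmPinv (A a) := fun i j => by
  refine measurable_of_tendsto_metrizable
    (f := fun (k : ℕ) a => (A a * (A a * A a + (1 / ((k : ℝ) + 1)) • 1)⁻¹) i j)
    (fun k => hA.mul ((hA.mul hA).add (const _)).inv i j) (tendsto_pi_nhds.2 fun a => ?_)
  exact ((tendsto_pi_nhds.1 ((tendsto_pi_nhds.1 (tendsto_regularized_inv (hs a))) i)) j)

lemma smoother {K : α → Matrix (Fin n) (Fin n) ℝ} {S : α → Matrix (Fin m) (Fin n) ℝ}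
    (hK : MeasurableEntries K) (hS : MeasurableEntries S) (hKt : ∀ a, (K a)ᵀ = K a) (lam : ℝ) :
    MeasurableEntries fun a => SketchedKRR.smoother (K a) (S a) lam :=
  ((hK.mul hS.transpose).mul (MeasurableEntries.symmPinv
    (((hS.mul (hK.mul hK)).mul hS.transpose).add (((hS.mul hK).mul hS.transpose).smul lam))
    fun a => normalMatrix_isHermitian (hKt a))).mul (hS.mul hK)

end MeasurableEntries

end Measurability

/-! ### Kernel matrices in the Hilbert space -/

section Kernel

variable {X : Type*} {H : Type*} [NormedAddCommGroup H]
    [InnerProductSpace ℝ H] [CompleteSpace H] [RKHS ℝ H X ℝ] {n : ℕ}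

lemma dotProduct_eval_eq_inner (f : H) (x : Fin n → X) (h : Fin n → ℝ) :
    (fun i => f (x i)) ⬝ᵥ h = inner ℝ f (∑ i, h i • RKHS.kerFun H (x i) (1 : ℝ)) := by
  simp only [inner_sum, inner_smul_right, RKHS.inner_kerFun, dotProduct]
  exact Finset.sum_congr rfl fun i _ => by simp [mul_comm]

lemma dotProduct_kernelMatrix (x : Fin n → X) (h : Fin n → ℝ) :
    h ⬝ᵥ (kernelMatrix (reproducingKernel H) x *ᵥ h) =
      (n : ℝ)⁻¹ * ‖∑ i, h i • RKHS.kerFun H (x i) (1 : ℝ)‖ ^ 2 := by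
  rw [← real_inner_self_eq_norm_sq, ← dotProduct_eval_eq_inner, dotProduct_comm]
  have h1 : ∀ i, (∑ j, h j • RKHS.kerFun H (x j) (1 : ℝ)) (x i) =
      ∑ j, reproducingKernel H (x i) (x j) * h j := fun i => by
    have h2 := map_sum (RKHS.coeCLM ℝ (H := H) (X := X) (V := ℝ))
      (fun j => h j • RKHS.kerFun H (x j) (1 : ℝ)) Finset.univ
    simp only [RKHS.coeCLM_apply] at h2
    rw [h2, Finset.sum_apply]
    refine Finset.sum_congr rfl fun j _ => ?_
    rw [RKHS.coe_smul, Pi.smul_apply, RKHS.kerFun_apply, smul_eq_mul, mul_comm]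
    rfl
  simp only [h1, dotProduct, Matrix.mulVec, kernelMatrix, Matrix.of_apply, Finset.mul_sum,
    Finset.sum_mul]
  refine Finset.sum_congr rfl fun i _ => Finset.sum_congr rfl fun j _ => by ring

lemma kernelMatrix_form_nonneg (x : Fin n → X) (h : Fin n → ℝ) :
    0 ≤ h ⬝ᵥ (kernelMatrix (reproducingKernel H) x *ᵥ h) := by
  rw [dotProduct_kernelMatrix]; positivity

lemma kernelMatrix_transpose (x : Fin n → X) :
    (kernelMatrix (reproducingKernel H) x)ᵀ = kernelMatrix (reproducingKernel H) x := by
  simpa [Matrix.IsHermitian] using kernelMatrix_isHermitian H x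

/-- Cauchy–Schwarz in H through the reproducing property; the n undoes the normalization of K. This
is the smoothness of `f₀` in the form that `KSatisfiable.bias_le` takes. -/
lemma sq_dotProduct_eval_le {f : H} {R : ℝ} (hf : ‖f‖ ≤ R) (hn : n ≠ 0) (x : Fin n → X)
    (h : Fin n → ℝ) : ((fun i => f (x i)) ⬝ᵥ h) ^ 2 ≤
      (n * R ^ 2) * (h ⬝ᵥ (kernelMatrix (reproducingKernel H) x *ᵥ h)) := by
  have hn' : (n : ℝ) ≠ 0 := by exact_mod_cast hn
  rw [dotProduct_eval_eq_inner, dotProduct_kernelMatrix]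
  set w := ∑ i, h i • RKHS.kerFun H (x i) (1 : ℝ)
  have h1 : |inner ℝ f w| ≤ R * ‖w‖ :=
    (abs_real_inner_le_norm f w).trans (mul_le_mul_of_nonneg_right hf (norm_nonneg _))
  calc (inner ℝ f w) ^ 2 = |inner ℝ f w| ^ 2 := (sq_abs _).symm
    _ ≤ (R * ‖w‖) ^ 2 := pow_le_pow_left₀ (abs_nonneg _) h1 2
    _ = _ := by field_simp

end Kernel

/-! ### Consequences of the Mercer expansion -/

lemma IsMercerExpansion.measurable_kernel {X : Type*} [MeasurableSpace X] {ν : Measure X}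
    {k : X → X → ℝ} {μ : ℕ → ℝ} {φ : ℕ → X → ℝ} (h : IsMercerExpansion ν k μ φ) :
    Measurable fun p : X × X => k p.1 p.2 := by
  refine measurable_of_tendsto_metrizable
    (f := fun (N : ℕ) (p : X × X) => ∑ i ∈ Finset.range N, μ i * φ i p.1 * φ i p.2)
    (fun N => Finset.measurable_sum _ fun i _ =>
      (((h.measurable i).comp measurable_fst).const_mul _).mul
        ((h.measurable i).comp measurable_snd)) (tendsto_pi_nhds.2 fun p => ?_)
  exact (h.expansion p.1 p.2).tendsto_sum_nat

/-- The quadratic form of the kernel matrix dominates that of a truncated Mercer expansion. -/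
lemma IsMercerExpansion.form_ge {X : Type*} [MeasurableSpace X] {ν : Measure X}
    {k : X → X → ℝ} {μ : ℕ → ℝ} {φ : ℕ → X → ℝ} (h : IsMercerExpansion ν k μ φ) {n : ℕ}
    (x : Fin n → X) (N : ℕ) (v : Fin n → ℝ) :
    μ N * ∑ j : Fin N, ((fun i => φ j (x i) / √n) ⬝ᵥ v) ^ 2 ≤
      v ⬝ᵥ (kernelMatrix k x *ᵥ v) := by
  have h1 : HasSum (fun j => μ j * ((fun i => φ j (x i) / √n) ⬝ᵥ v) ^ 2)
      (v ⬝ᵥ (kernelMatrix k x *ᵥ v)) := by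
    have h2 : HasSum (fun j => ∑ i, ∑ l, v i * ((n : ℝ)⁻¹ * (μ j * φ j (x i) * φ j (x l)) * v l))
        (∑ i, ∑ l, v i * ((n : ℝ)⁻¹ * k (x i) (x l) * v l)) :=
      hasSum_sum fun i _ => hasSum_sum fun l _ =>
        (((h.expansion (x i) (x l)).mul_left _).mul_right _).mul_left _
    convert h2 using 1
    · funext j
      rw [sq, dotProduct, Finset.sum_mul_sum, Finset.mul_sum]
      refine Finset.sum_congr rfl fun i _ => ?_
      rw [Finset.mul_sum]
      refine Finset.sum_congr rfl fun l _ => ?_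
      have h3 : (n : ℝ)⁻¹ = (√(n : ℝ))⁻¹ * (√(n : ℝ))⁻¹ := by
        rw [← mul_inv, Real.mul_self_sqrt (Nat.cast_nonneg n)]
      rw [h3]
      ring
    · simp only [dotProduct, Matrix.mulVec, kernelMatrix, Matrix.of_apply, Finset.mul_sum]
  have h4 := sum_le_hasSum (Finset.range N)
    (fun j _ => mul_nonneg (h.pos j).le (sq_nonneg _)) h1
  refine le_trans ?_ h4
  rw [Finset.mul_sum, Finset.sum_range]
  exact Finset.sum_le_sum fun j _ =>
    mul_le_mul_of_nonneg_right (h.antitone j.2.le) (sq_nonneg _)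

/-! ### Quadratic forms in noise with two moments -/

section QuadraticForm

variable {Ω : Type*} [MeasurableSpace Ω] {P : Measure Ω} {n : ℕ}

lemma sum_sum_eq_diag_add (f : Fin n → Fin n → ℝ) (hf : ∀ i j, f i j = f j i) :
    ∑ i, ∑ j, f i j = ∑ i, f i i + ∑ p : Fin n × Fin n with p.1 < p.2, 2 * f p.1 p.2 := by
  have h1 : ∀ i j, f i j = (if i = j then f i j else 0) + (if i < j then f i j else 0) +
      (if j < i then f i j else 0) := fun i j => by
    rcases lt_trichotomy i j with h | h | h
    · simp [h, h.ne, h.not_gt]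
    · simp [h]
    · simp [h, h.ne', h.not_gt]
  have h2 : ∑ i, ∑ j, (if j < i then f i j else 0) = ∑ i, ∑ j, (if i < j then f i j else 0) := by
    rw [Finset.sum_comm]
    simp only [hf]
  rw [Finset.sum_filter, Fintype.sum_prod_type]
  calc ∑ i, ∑ j, f i j = ∑ i, ∑ j, ((if i = j then f i j else 0) + (if i < j then f i j else 0) +
      (if j < i then f i j else 0)) :=
        Finset.sum_congr rfl fun i _ => Finset.sum_congr rfl fun j _ => h1 i j
    _ = _ := by
      simp only [Finset.sum_add_distrib, h2, Finset.sum_ite_eq, Finset.mem_univ, if_true]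
      rw [add_assoc, ← two_mul, Finset.mul_sum]
      simp only [Finset.mul_sum, mul_ite, mul_zero]

variable {e : Fin n → Ω → ℝ}

/-- The variable with index i is centered and independent of the product of the others. Among j, k,
l repetitions are allowed. -/
lemma integral_mul_three_eq_zero (hm : ∀ i, Measurable (e i)) (hi : iIndepFun e P)
    (h0 : ∀ i, ∫ ω, e i ω ∂P = 0) {i j k l : Fin n} (hj : i ≠ j) (hk : i ≠ k) (hl : i ≠ l) :
    ∫ ω, e i ω * (e j ω * (e k ω * e l ω)) ∂P = 0 := by
  have h1 := hi.indepFun_finset {i} {j, k, l} (by simp [hj, hk, hl]) hm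
  have h2 : IndepFun (e i) (fun ω => e j ω * (e k ω * e l ω)) P :=
    h1.comp (φ := fun v : ({i} : Finset (Fin n)) → ℝ => v ⟨i, by simp⟩)
      (ψ := fun v : ({j, k, l} : Finset (Fin n)) → ℝ =>
        v ⟨j, by simp⟩ * (v ⟨k, by simp⟩ * v ⟨l, by simp⟩))
      (by fun_prop) (by fun_prop)
  have h3 := h2.integral_mul_eq_mul_integral (hm i).aestronglyMeasurable
    ((hm j).mul ((hm k).mul (hm l))).aestronglyMeasurable
  rw [h0, zero_mul] at h3
  exact h3

/-- By independence e_i² e_j² is integrable as soon as both factors are; for i = j a fourth moment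
would be needed. -/
lemma memLp_pair (hm : ∀ i, Measurable (e i)) (hi : iIndepFun e P)
    (h2 : ∀ i, MemLp (e i) 2 P) {i j : Fin n} (hij : i ≠ j) :
    MemLp (fun ω => e i ω * e j ω) 2 P := by
  refine (memLp_two_iff_integrable_sq (f := fun ω => e i ω * e j ω)
    ((hm i).mul (hm j)).aestronglyMeasurable).2 ?_
  have h3 : IndepFun (fun ω => e i ω ^ 2) (fun ω => e j ω ^ 2) P :=
    (hi.indepFun hij).comp (φ := fun t : ℝ => t ^ 2) (ψ := fun t : ℝ => t ^ 2)
      (by fun_prop) (by fun_prop)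
  have h4 := h3.integrable_mul (h2 i).integrable_sq (h2 j).integrable_sq
  refine h4.congr (ae_of_all _ fun ω => ?_)
  simp only [Pi.mul_apply]
  ring

/-- Two different increasing pairs leave some index of p outside q, and that centered factor kills
the integral. -/
lemma integral_pair_mul_pair (hm : ∀ i, Measurable (e i)) (hi : iIndepFun e P)
    (h0 : ∀ i, ∫ ω, e i ω ∂P = 0) (h1 : ∀ i, ∫ ω, e i ω ^ 2 ∂P = 1)
    {p q : Fin n × Fin n} (hp : p.1 < p.2) (hq : q.1 < q.2) :
    ∫ ω, (e p.1 ω * e p.2 ω) * (e q.1 ω * e q.2 ω) ∂P = if p = q then 1 else 0 := by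
  obtain ⟨i, j⟩ := p
  obtain ⟨k, l⟩ := q
  simp only at hp hq ⊢
  split_ifs with h
  · obtain ⟨rfl, rfl⟩ := Prod.mk.inj h
    have h2 : IndepFun (fun ω => e i ω ^ 2) (fun ω => e j ω ^ 2) P :=
      (hi.indepFun hp.ne).comp (φ := fun t : ℝ => t ^ 2) (ψ := fun t : ℝ => t ^ 2)
        (by fun_prop) (by fun_prop)
    have h3 := h2.integral_mul_eq_mul_integral ((hm i).pow_const 2).aestronglyMeasurable
      ((hm j).pow_const 2).aestronglyMeasurable
    rw [h1, h1, mul_one] at h3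
    rw [← h3]
    refine integral_congr_ae (ae_of_all _ fun ω => ?_)
    simp only [Pi.mul_apply]
    ring
  · by_cases hc : i = k ∨ i = l
    · have hjk : j ≠ k := by
        rintro rfl
        rcases hc with rfl | rfl
        · exact lt_irrefl _ hp
        · exact lt_asymm hp hq
      have hjl : j ≠ l := by
        rintro rfl
        rcases hc with rfl | rfl
        · exact h rfl
        · exact lt_irrefl _ hp
      rw [← integral_mul_three_eq_zero hm hi h0 hp.ne' hjk hjl]
      exact integral_congr_ae (ae_of_all _ fun ω => by ring)
    · push Not at hc
      rw [← integral_mul_three_eq_zero hm hi h0 hp.ne hc.1 hc.2]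
      exact integral_congr_ae (ae_of_all _ fun ω => by ring)

/-- The second moment of an off-diagonal quadratic form in independent centered variables. -/
lemma integrable_and_integral_offDiag_sq (hm : ∀ i, Measurable (e i)) (hi : iIndepFun e P)
    (h0 : ∀ i, ∫ ω, e i ω ∂P = 0) (h1 : ∀ i, ∫ ω, e i ω ^ 2 ∂P = 1)
    (h2 : ∀ i, MemLp (e i) 2 P) (c : Fin n × Fin n → ℝ) :
    Integrable (fun ω => (∑ p with p.1 < p.2, c p * (e p.1 ω * e p.2 ω)) ^ 2) P ∧
      ∫ ω, (∑ p with p.1 < p.2, c p * (e p.1 ω * e p.2 ω)) ^ 2 ∂P =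
        ∑ p with p.1 < p.2, c p ^ 2 := by
  have hLp : ∀ p ∈ Finset.univ.filter (fun p : Fin n × Fin n => p.1 < p.2),
      MemLp (fun ω => e p.1 ω * e p.2 ω) 2 P := fun p hp =>
    memLp_pair hm hi h2 (Finset.mem_filter.1 hp).2.ne
  have hint : ∀ p ∈ Finset.univ.filter (fun p : Fin n × Fin n => p.1 < p.2),
      ∀ q ∈ Finset.univ.filter (fun p : Fin n × Fin n => p.1 < p.2),
      Integrable (fun ω => c p * c q * ((e p.1 ω * e p.2 ω) * (e q.1 ω * e q.2 ω))) P :=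
    fun p hp q hq => ((hLp p hp).integrable_mul (hLp q hq)).const_mul _
  have hexp : (fun ω => (∑ p with p.1 < p.2, c p * (e p.1 ω * e p.2 ω)) ^ 2) = fun ω =>
      ∑ p with p.1 < p.2, ∑ q with q.1 < q.2,
        c p * c q * ((e p.1 ω * e p.2 ω) * (e q.1 ω * e q.2 ω)) := by
    funext ω
    rw [sq, Finset.sum_mul_sum]
    exact Finset.sum_congr rfl fun p _ => Finset.sum_congr rfl fun q _ => by ring
  rw [hexp]
  refine ⟨integrable_finsetSum _ fun p hp => integrable_finsetSum _ fun q hq => hint p hp q hq, ?_⟩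
  rw [integral_finsetSum _ fun p hp => integrable_finsetSum _ fun q hq => hint p hp q hq]
  refine Finset.sum_congr rfl fun p hp => ?_
  rw [integral_finsetSum _ fun q hq => hint p hp q hq]
  have h3 : ∀ q ∈ Finset.univ.filter (fun p : Fin n × Fin n => p.1 < p.2),
      ∫ ω, c p * c q * ((e p.1 ω * e p.2 ω) * (e q.1 ω * e q.2 ω)) ∂P =
        if p = q then c p * c q else 0 := fun q hq => by
    rw [integral_const_mul, integral_pair_mul_pair hm hi h0 h1 (Finset.mem_filter.1 hp).2
      (Finset.mem_filter.1 hq).2]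
    simp
  rw [Finset.sum_congr rfl h3, Finset.sum_ite_eq, if_pos hp, sq]

variable [IsProbabilityMeasure P]

/-- A tail bound for quadratic forms in independent standardized variables that uses no moments
beyond the second. -/
lemma quadForm_tail (hm : ∀ i, Measurable (e i)) (hi : iIndepFun e P)
    (h0 : ∀ i, ∫ ω, e i ω ∂P = 0) (h1 : ∀ i, ∫ ω, e i ω ^ 2 ∂P = 1)
    (h2 : ∀ i, MemLp (e i) 2 P) {M δ : ℝ} (hM : 0 ≤ M) (hδ0 : 0 ≤ δ)
    (hδ : ∀ i, ∫ ω, (e i ω ^ 2 - min (e i ω ^ 2) M) ∂P ≤ δ)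
    {A : Matrix (Fin n) (Fin n) ℝ} (hA : ∀ i j, A i j = A j i) (hAd : ∀ i, 0 ≤ A i i)
    (hAf : ∑ i, ∑ j, A i j ^ 2 ≤ A.trace) {τ : ℝ} (hτ : 0 < τ) (hAτ : A.trace ≤ τ) :
    P.real {ω | 4 * τ < ∑ i, ∑ j, A i j * (e i ω * e j ω)} ≤ δ + (2 + M ^ 2) / τ := by
  -- Off-diagonal part O, truncated diagonal W and remainder V, with thresholds τ, 2τ and τ adding
  -- up to 4τ.
  set O : Ω → ℝ := fun ω => ∑ p : Fin n × Fin n with p.1 < p.2, 2 * A p.1 p.2 * (e p.1 ω * e p.2 ω) with hO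
  set W : Ω → ℝ := fun ω => ∑ i, A i i * min (e i ω ^ 2) M with hW
  set V : Ω → ℝ := fun ω => ∑ i, A i i * (e i ω ^ 2 - min (e i ω ^ 2) M) with hV
  have hdec : ∀ ω, ∑ i, ∑ j, A i j * (e i ω * e j ω) = O ω + W ω + V ω := fun ω => by
    rw [sum_sum_eq_diag_add (fun i j => A i j * (e i ω * e j ω))
      (fun i j => by rw [hA i j, mul_comm (e i ω)]), add_assoc, hW, hV, hO]
    simp only
    rw [← Finset.sum_add_distrib, add_comm]
    refine congrArg₂ (· + ·) (Finset.sum_congr rfl fun p _ => by ring)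
      (Finset.sum_congr rfl fun i _ => by ring)
  have hAf2 := sum_sum_eq_diag_add (fun i j => A i j ^ 2) (fun i j => by rw [hA i j])
  have hdiag0 : 0 ≤ ∑ i, A i i ^ 2 := Finset.sum_nonneg fun i _ => sq_nonneg _
  have hoff0 : 0 ≤ ∑ p : Fin n × Fin n with p.1 < p.2, 2 * A p.1 p.2 ^ 2 :=
    Finset.sum_nonneg fun p _ => by positivity
  -- off-diagonal part
  have hOt : P.real {ω | τ ^ 2 ≤ O ω ^ 2} ≤ 2 / τ := by
    obtain ⟨hint, hval⟩ := integrable_and_integral_offDiag_sq hm hi h0 h1 h2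
      fun p => 2 * A p.1 p.2
    have h3 := mul_meas_ge_le_integral_of_nonneg (μ := P) (f := fun ω => O ω ^ 2)
      (ae_of_all _ fun ω => sq_nonneg _) hint (τ ^ 2)
    -- The second moment is twice the off-diagonal part of ‖A‖²_F, which is at most tr A ≤ τ.
    have h4 : ∫ ω, O ω ^ 2 ∂P ≤ 2 * τ := by
      have h5 : ∑ p : Fin n × Fin n with p.1 < p.2, (2 * A p.1 p.2) ^ 2 =
          2 * ∑ p : Fin n × Fin n with p.1 < p.2, 2 * A p.1 p.2 ^ 2 := by
        rw [Finset.mul_sum]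
        exact Finset.sum_congr rfl fun p _ => by ring
      rw [hO, hval, h5]
      linarith
    rw [le_div_iff₀ hτ]
    have h6 := h3.trans h4
    nlinarith
  -- truncated diagonal part
  have hmin_meas : ∀ i, Measurable fun ω => min (e i ω ^ 2) M := fun i =>
    ((hm i).pow_const 2).min measurable_const
  have hmin_int : ∀ i, Integrable (fun ω => min (e i ω ^ 2) M) P := fun i => by
    refine Integrable.of_bound (hmin_meas i).aestronglyMeasurable M (ae_of_all _ fun ω => ?_)
    rw [Real.norm_of_nonneg (le_min (sq_nonneg _) hM)]
    exact min_le_right _ _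
  have hWt : P.real {ω | 2 * τ ≤ W ω} ≤ M ^ 2 / τ := by
    have hLp : ∀ i, MemLp (fun ω => A i i * min (e i ω ^ 2) M) 2 P := fun i => by
      refine MemLp.of_bound ((hmin_meas i).const_mul _).aestronglyMeasurable (A i i * M)
        (ae_of_all _ fun ω => ?_)
      rw [Real.norm_of_nonneg (mul_nonneg (hAd i) (le_min (sq_nonneg _) hM))]
      exact mul_le_mul_of_nonneg_left (min_le_right _ _) (hAd i)
    have hWsum : W = ∑ i, fun ω => A i i * min (e i ω ^ 2) M := by
      funext ω; rw [Finset.sum_apply]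
    have hindep : iIndepFun (fun i ω => A i i * min (e i ω ^ 2) M) P :=
      hi.comp (fun i t => A i i * min (t ^ 2) M) fun i => by fun_prop
    have hvar : Var[W; P] ≤ M ^ 2 * τ := by
      rw [hWsum, IndepFun.variance_sum (fun i _ => hLp i)
        (fun i _ j _ hij => hindep.indepFun hij)]
      have h3 : ∀ i, Var[fun ω => A i i * min (e i ω ^ 2) M; P] ≤ M ^ 2 * A i i ^ 2 := fun i => by
        refine (variance_le_sq_of_bounded (a := 0) (b := A i i * M) (ae_of_all _ fun ω => ⟨mul_nonneg (hAd i)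
          (le_min (sq_nonneg _) hM), mul_le_mul_of_nonneg_left (min_le_right _ _) (hAd i)⟩)
          ((hmin_meas i).const_mul _).aemeasurable).trans ?_
        nlinarith [sq_nonneg (A i i * M)]
      refine (Finset.sum_le_sum fun i _ => h3 i).trans ?_
      rw [← Finset.mul_sum]
      exact mul_le_mul_of_nonneg_left (by linarith) (sq_nonneg _)
    have hmean : ∫ ω, W ω ∂P ≤ τ := by
      rw [hW, integral_finsetSum _ fun i _ => (hmin_int i).const_mul _]
      refine le_trans (Finset.sum_le_sum fun i _ => ?_) hAτ
      rw [integral_const_mul, Matrix.diag_apply]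
      refine mul_le_of_le_one_right (hAd i) ?_
      rw [← h1 i]
      exact integral_mono (hmin_int i) (h2 i).integrable_sq fun ω => min_le_left _ _
    have hWLp : MemLp W 2 P := by
      rw [hWsum]; exact memLp_finsetSum' _ fun i _ => hLp i
    have h4 := meas_ge_le_variance_div_sq hWLp hτ
    have h5 : P.real {ω | τ ≤ |W ω - ∫ ω, W ω ∂P|} ≤ Var[W; P] / τ ^ 2 :=
      ENNReal.toReal_le_of_le_ofReal (div_nonneg (variance_nonneg _ _) (sq_nonneg _)) h4
    refine (measureReal_mono (fun ω (hω : 2 * τ ≤ W ω) => ?_)).trans (h5.trans ?_)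
    · exact le_trans (le_sub_iff_add_le.2
        ((add_le_add le_rfl hmean).trans ((two_mul τ).symm.le.trans hω))) (le_abs_self _)
    · rw [div_le_div_iff₀ (by positivity) hτ]
      nlinarith [mul_le_mul_of_nonneg_right hvar hτ.le]
  -- remainder
  have hVt : P.real {ω | τ ≤ V ω} ≤ δ := by
    have hint : ∀ i, Integrable (fun ω => A i i * (e i ω ^ 2 - min (e i ω ^ 2) M)) P := fun i =>
      ((h2 i).integrable_sq.sub (hmin_int i)).const_mul _
    have h3 := mul_meas_ge_le_integral_of_nonneg (μ := P) (f := V)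
      (ae_of_all _ fun ω => Finset.sum_nonneg fun i _ =>
        mul_nonneg (hAd i) (sub_nonneg.2 (min_le_left _ _)))
      (integrable_finsetSum _ fun i _ => hint i) τ
    have h4 : ∫ ω, V ω ∂P ≤ A.trace * δ := by
      rw [hV, integral_finsetSum _ fun i _ => hint i, Matrix.trace, Finset.sum_mul]
      refine Finset.sum_le_sum fun i _ => ?_
      rw [integral_const_mul]
      exact mul_le_mul_of_nonneg_left (hδ i) (hAd i)
    exact le_of_mul_le_mul_left (h3.trans (h4.trans (mul_le_mul_of_nonneg_right hAτ hδ0))) hτ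
  have hsub : {ω | 4 * τ < ∑ i, ∑ j, A i j * (e i ω * e j ω)} ⊆
      {ω | τ ≤ V ω} ∪ ({ω | τ ^ 2 ≤ O ω ^ 2} ∪ {ω | 2 * τ ≤ W ω}) := by
    intro ω hω
    by_contra hcon
    simp only [Set.mem_union, Set.mem_ofPred_eq, not_or, not_le] at hcon hω
    rw [hdec] at hω
    have := abs_lt_of_sq_lt_sq hcon.2.1 hτ.le
    have := le_abs_self (O ω)
    linarith
  refine (measureReal_mono hsub).trans ((measureReal_union_le _ _).trans ?_)
  rw [add_div]
  exact add_le_add hVt ((measureReal_union_le _ _).trans (add_le_add hOt hWt))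

/-- The tail bound for quadratic forms with a random matrix independent of the variables. -/
lemma random_quadForm_tail (hm : ∀ i, Measurable (e i)) (hi : iIndepFun e P)
    (h0 : ∀ i, ∫ ω, e i ω ∂P = 0) (h1 : ∀ i, ∫ ω, e i ω ^ 2 ∂P = 1)
    (h2 : ∀ i, MemLp (e i) 2 P) {M δ : ℝ} (hM : 0 ≤ M) (hδ0 : 0 ≤ δ)
    (hδ : ∀ i, ∫ ω, (e i ω ^ 2 - min (e i ω ^ 2) M) ∂P ≤ δ)
    {𝒵 : Type*} [MeasurableSpace 𝒵] {Z : Ω → 𝒵} (hZ : Measurable Z)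
    (hZe : IndepFun Z (fun ω i => e i ω) P)
    {A : 𝒵 → Matrix (Fin n) (Fin n) ℝ} (hAm : MeasurableEntries A)
    (hA : ∀ z i j, A z i j = A z j i) (hAd : ∀ z i, 0 ≤ A z i i)
    (hAf : ∀ z, ∑ i, ∑ j, A z i j ^ 2 ≤ (A z).trace) {a T : ℝ} (ha : 0 ≤ a) (hT : 0 < T) :
    P.real {ω | T ≤ (A (Z ω)).trace + a ∧
      4 * ((A (Z ω)).trace + a) < ∑ i, ∑ j, A (Z ω) i j * (e i ω * e j ω)} ≤
        δ + (2 + M ^ 2) / T := by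
  set B : Set (𝒵 × (Fin n → ℝ)) := {p | T ≤ (A p.1).trace + a ∧
    4 * ((A p.1).trace + a) < ∑ i, ∑ j, A p.1 i j * (p.2 i * p.2 j)} with hB
  have hAm' : ∀ i j, Measurable fun p : 𝒵 × (Fin n → ℝ) => A p.1 i j := fun i j =>
    (hAm i j).comp measurable_fst
  have htr : Measurable fun p : 𝒵 × (Fin n → ℝ) => (A p.1).trace + a :=
    (Finset.measurable_sum _ fun i _ => hAm' i i).add_const a
  have hquad : Measurable fun p : 𝒵 × (Fin n → ℝ) => ∑ i, ∑ j, A p.1 i j * (p.2 i * p.2 j) :=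
    Finset.measurable_sum _ fun i _ => Finset.measurable_sum _ fun j _ =>
      (hAm' i j).mul (by fun_prop)
  have hBm : MeasurableSet B :=
    (measurableSet_le measurable_const htr).inter (measurableSet_lt (htr.const_mul 4) hquad)
  have hem : Measurable fun ω i => e i ω := measurable_pi_lambda _ hm
  have hprod := (indepFun_iff_map_prod_eq_prod_map_map hZ.aemeasurable hem.aemeasurable).1 hZe
  have hbound : 0 ≤ δ + (2 + M ^ 2) / T := by positivity
  have : IsProbabilityMeasure (P.map Z) := Measure.isProbabilityMeasure_map hZ.aemeasurable
  have : IsProbabilityMeasure (P.map fun ω i => e i ω) :=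
    Measure.isProbabilityMeasure_map hem.aemeasurable
  refine ENNReal.toReal_le_of_le_ofReal hbound ?_
  calc P {ω | T ≤ (A (Z ω)).trace + a ∧
        4 * ((A (Z ω)).trace + a) < ∑ i, ∑ j, A (Z ω) i j * (e i ω * e j ω)}
      = (P.map fun ω => (Z ω, fun i => e i ω)) B := by
        rw [Measure.map_apply (hZ.prodMk hem) hBm]
        rfl
    _ = ∫⁻ z, (P.map fun ω i => e i ω) (Prod.mk z ⁻¹' B) ∂(P.map Z) := by
        rw [hprod, Measure.prod_apply hBm]
    _ ≤ ∫⁻ _, ENNReal.ofReal (δ + (2 + M ^ 2) / T) ∂(P.map Z) := by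
        refine lintegral_mono fun z => ?_
        rw [Measure.map_apply hem (measurable_prodMk_left hBm)]
        by_cases hz : T ≤ (A z).trace + a
        · have hτ : 0 < (A z).trace + a := hT.trans_le hz
          have h3 := quadForm_tail hm hi h0 h1 h2 hM hδ0 hδ (hA z) (hAd z) (hAf z) hτ
            (le_add_of_nonneg_right ha)
          have h4 : δ + (2 + M ^ 2) / ((A z).trace + a) ≤ δ + (2 + M ^ 2) / T := by gcongr
          refine (ENNReal.le_ofReal_iff_toReal_le (measure_ne_top _ _) hbound).2 ?_
          exact (measureReal_mono fun ω hω => hω.2).trans (h3.trans h4)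
        -- The requirement T ≤ tr A + a is part of the event, so this fibre is empty.
        · have h3 : (fun ω i => e i ω) ⁻¹' (Prod.mk z ⁻¹' B) = ∅ := by
            ext ω
            simp [hB, hz]
          rw [h3, measure_empty]
          exact zero_le
    _ = ENNReal.ofReal (δ + (2 + M ^ 2) / T) := by simp

end QuadraticForm

/-! ### Properties of Δ² and the deterministic risk bound -/

section Deterministic

variable {n s : ℕ} {K : Matrix (Fin n) (Fin n) ℝ} {S : Matrix (Fin s) (Fin n) ℝ} {lam c : ℝ}

lemma smoother_sq_symm (hK : Kᵀ = K) (i j : Fin n) :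
    (smoother K S lam * smoother K S lam) i j = (smoother K S lam * smoother K S lam) j i := by
  have h : (smoother K S lam * smoother K S lam)ᵀ = smoother K S lam * smoother K S lam := by
    rw [Matrix.transpose_mul, smoother_transpose hK]
  exact congrFun (congrFun h j) i

lemma smoother_sq_diag (hK : Kᵀ = K) (i : Fin n) :
    (smoother K S lam * smoother K S lam) i i =
      (smoother K S lam).col i ⬝ᵥ (smoother K S lam).col i := by
  nth_rw 1 [← smoother_transpose (S := S) (lam := lam) hK]
  rfl

/-- The columns of Δ² are Δ applied to columns of Δ, and Δ is a contraction; the squared column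
norms of Δ sum to tr(Δ²). -/
lemma smoother_sq_frobenius_le (hK : Kᵀ = K) (hp : ∀ v, 0 ≤ v ⬝ᵥ (K *ᵥ v)) (hl : 0 ≤ lam) :
    ∑ i, ∑ j, (smoother K S lam * smoother K S lam) i j ^ 2 ≤
      (smoother K S lam * smoother K S lam).trace := by
  rw [Finset.sum_comm]
  refine Finset.sum_le_sum fun j _ => ?_
  rw [Matrix.diag_apply, smoother_sq_diag hK]
  refine le_trans (le_of_eq ?_) (smoother_contraction (S := S) hK hp hl _)
  rw [dotProduct_self_eq_sum_sq]
  rfl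

lemma smoother_sq_trace_nonneg (hK : Kᵀ = K) :
    0 ≤ (smoother K S lam * smoother K S lam).trace :=
  Finset.sum_nonneg fun i _ => by
    rw [Matrix.diag_apply, smoother_sq_diag hK]
    exact dotProduct_self_nonneg _

lemma smoother_mulVec_dotProduct_self (hK : Kᵀ = K) (e : Fin n → ℝ) :
    (smoother K S lam *ᵥ e) ⬝ᵥ (smoother K S lam *ᵥ e) =
      ∑ i, ∑ j, (smoother K S lam * smoother K S lam) i j * (e i * e j) := by
  rw [Matrix.dotProduct_mulVec, ← Matrix.mulVec_transpose, smoother_transpose hK,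
    Matrix.mulVec_mulVec, dotProduct_comm]
  simp only [dotProduct, Matrix.mulVec, Finset.mul_sum]
  exact Finset.sum_congr rfl fun i _ => Finset.sum_congr rfl fun j _ => by ring

/-- The risk bound on the event that the sketch is satisfiable and the noise is controlled. -/
lemma empNormSq_le {X : Type*} {H : Type*} [NormedAddCommGroup H] [InnerProductSpace ℝ H]
    [CompleteSpace H] [RKHS ℝ H X ℝ] {f₀ : H} {R : ℝ} (hf₀ : ‖f₀‖ ≤ R) (hn : n ≠ 0)
    {x : Fin n → X} {e : Fin n → ℝ} {f : X → ℝ} (hl : 0 < lam)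
    (hS : KSatisfiable (kernelMatrix (reproducingKernel H) x) S lam c)
    (hf : IsSketchedKRR (reproducingKernel H) x S lam (fun i => f₀ (x i) + e i) f)
    (he : ∑ i, ∑ j, (smoother (kernelMatrix (reproducingKernel H) x) S lam *
        smoother (kernelMatrix (reproducingKernel H) x) S lam) i j * (e i * e j) ≤
      4 * ((smoother (kernelMatrix (reproducingKernel H) x) S lam *
        smoother (kernelMatrix (reproducingKernel H) x) S lam).trace + n * lam)) :
    empNormSq x (fun t => f t - f₀ t) ≤ (8 + 2 * (R ^ 2 * (3 + 6 * c ^ 2))) *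
      (lam + varianceTerm (kernelMatrix (reproducingKernel H) x) S lam) := by
  set K := kernelMatrix (reproducingKernel H) x with hKdef
  have hK : K.IsHermitian := kernelMatrix_isHermitian H x
  have hKt : Kᵀ = K := kernelMatrix_transpose x
  have hp : ∀ v, 0 ≤ v ⬝ᵥ (K *ᵥ v) := kernelMatrix_form_nonneg x
  set F : Fin n → ℝ := fun i => f₀ (x i) with hF
  have hnpos : (0 : ℝ) < n := by exact_mod_cast Nat.pos_of_ne_zero hn
  have hbias := hS.bias_le hK hp hl (f := F) (B := n * R ^ 2) (by positivity)
    (sq_dotProduct_eval_le hf₀ hn x)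
  rw [← smoother_mulVec_dotProduct_self hKt] at he
  have htr := smoother_sq_trace_nonneg (S := S) (lam := lam) hKt
  set Δ := smoother K S lam with hΔ
  have hsum : ∑ i, (f (x i) - f₀ (x i)) ^ 2 ≤
      2 * ((Δ *ᵥ e) ⬝ᵥ (Δ *ᵥ e)) + 2 * ((F - Δ *ᵥ F) ⬝ᵥ (F - Δ *ᵥ F)) := by
    rw [dotProduct_self_eq_sum_sq, dotProduct_self_eq_sum_sq, Finset.mul_sum, Finset.mul_sum,
      ← Finset.sum_add_distrib]
    refine Finset.sum_le_sum fun i _ => ?_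
    have hfit : f (x i) = (Δ *ᵥ F) i + (Δ *ᵥ e) i := by
      rw [hf.fitted hn hKt hp hl.le i, ← Pi.add_apply, ← Matrix.mulVec_add]
      rfl
    rw [hfit, Pi.sub_apply]
    nlinarith [sq_nonneg ((Δ *ᵥ e) i + (F i - (Δ *ᵥ F) i))]
  have hmain : ∑ i, (f (x i) - f₀ (x i)) ^ 2 ≤
      (8 + 2 * (R ^ 2 * (3 + 6 * c ^ 2))) * (n * lam + (Δ * Δ).trace) := by
    have h1 : 0 ≤ 2 * (R ^ 2 * (3 + 6 * c ^ 2)) * (Δ * Δ).trace := mul_nonneg (by positivity) htr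
    linarith
  rw [empNormSq, varianceTerm, inv_mul_le_iff₀ hnpos]
  refine hmain.trans (le_of_eq ?_)
  field_simp
  rw [hΔ]

end Deterministic

/-! ### Probability of an unsatisfiable sketch -/

lemma expNeg_nonneg (a : ℝ≥0∞) : 0 ≤ expNeg a := by
  unfold expNeg; split_ifs <;> positivity

lemma expNeg_le {a : ℝ≥0∞} {r : ℝ} (h : ENNReal.ofReal r ≤ a) :
    expNeg a ≤ Real.exp (-r) := by
  unfold expNeg
  split_ifs with ha
  · positivity
  · exact Real.exp_le_exp.2 (neg_le_neg ((ENNReal.ofReal_le_iff_le_toReal ha).1 h))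

lemma tendsto_expNeg {a : ℕ → ℝ≥0∞} (h : Tendsto a atTop (𝓝 ∞)) :
    Tendsto (fun n => expNeg (a n)) atTop (𝓝 0) := by
  rw [Metric.tendsto_atTop']
  intro η hη
  obtain ⟨r, hr⟩ : ∃ r : ℝ, Real.exp (-r) < η :=
    (Real.tendsto_exp_neg_atTop_nhds_zero.eventually_lt_const hη).exists
  obtain ⟨N, hN⟩ := eventually_atTop.1 (h.eventually_const_le (ENNReal.ofReal_lt_top (r := r)))
  refine ⟨N, fun n hn => ?_⟩
  rw [Real.dist_0_eq_abs, abs_of_nonneg (expNeg_nonneg _)]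
  exact (expNeg_le (hN n hn.le)).trans_lt hr

/-- Markov's inequality for the conditional probability gives P(E) ≥ (1 − e^{-a})(1 − e^{-b}).
Measurability of E need not be assumed, as the type condition forces it up to null sets. -/
lemma IsOfType.measureReal_compl_le {Ω : Type*} {m mΩ : MeasurableSpace Ω} {P : Measure Ω}
    [IsProbabilityMeasure P] (hmΩ : m ≤ mΩ) {E : Set Ω}
    {a b : ℝ≥0∞} (h : IsOfType P m E a b) (ha : expNeg a < 1) (hb : expNeg b < 1) :
    P.real Eᶜ ≤ expNeg a + expNeg b := by
  unfold IsOfType at h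
  by_cases hint : Integrable (E.indicator fun _ => (1 : ℝ)) P
  · have hE : NullMeasurableSet E P :=
      (aemeasurable_indicator_const_iff (1 : ℝ)).1 hint.aemeasurable
    have h1 := mul_meas_ge_le_integral_of_nonneg (μ := P) (f := P⟦E | m⟧)
      (condExp_nonneg (ae_of_all _ fun ω => Set.indicator_nonneg (fun _ _ => zero_le_one) ω))
      integrable_condExp (1 - expNeg a)
    rw [integral_condExp hmΩ, integral_indicator₀ hE] at h1
    simp only [integral_const, smul_eq_mul, mul_one, measureReal_restrict_apply_univ] at h1
    have h2 : P.real Eᶜ = 1 - P.real E := by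
      rw [measureReal_compl₀ hE, probReal_univ]
    rw [h2]
    have h3 := mul_le_mul_of_nonneg_left h (sub_nonneg.2 ha.le)
    nlinarith [mul_nonneg (expNeg_nonneg a) (expNeg_nonneg b)]
  -- If the indicator is not integrable its conditional expectation is 0 by convention; the event in
  -- the type condition is then empty, against e^{-b} < 1.
  · exfalso
    have h1 : {ω | 1 - expNeg a ≤ (P⟦E | m⟧) ω} = ∅ := by
      rw [condExp_of_not_integrable hint]
      ext ω
      simp [ha]
    rw [h1, measureReal_empty] at h
    linarith

/-! ### Truncation level and law of large numbers -/

section Events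

variable {Ω : Type*} [MeasurableSpace Ω] {P : Measure Ω}

/-- Dominated convergence with dominating function e². Identical distribution lets one M serve all
noise variables. -/
lemma exists_truncation {e : Ω → ℝ} (hm : Measurable e) (h2 : MemLp e 2 P) {η : ℝ} (hη : 0 < η) :
    ∃ M : ℝ, 0 ≤ M ∧ ∫ ω, (e ω ^ 2 - min (e ω ^ 2) M) ∂P ≤ η := by
  have h : Tendsto (fun N : ℕ => ∫ ω, (e ω ^ 2 - min (e ω ^ 2) (N : ℝ)) ∂P) atTop
      (𝓝 (∫ _, (0 : ℝ) ∂P)) := by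
    refine tendsto_integral_of_dominated_convergence (fun ω => e ω ^ 2)
      (fun N => (((hm.pow_const 2).sub
        ((hm.pow_const 2).min measurable_const))).aestronglyMeasurable) h2.integrable_sq
      (fun N => ae_of_all _ fun ω => ?_) (ae_of_all _ fun ω => ?_)
    · rw [Real.norm_of_nonneg (sub_nonneg.2 (min_le_left _ _))]
      exact sub_le_self _ (le_min (sq_nonneg _) (Nat.cast_nonneg N))
    · obtain ⟨N, hN⟩ := exists_nat_ge (e ω ^ 2)
      refine tendsto_const_nhds.congr' ?_
      filter_upwards [eventually_ge_atTop N] with k hk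
      have : e ω ^ 2 ≤ k := hN.trans (by exact_mod_cast hk)
      rw [min_eq_left this, sub_self]
  rw [integral_zero] at h
  obtain ⟨N, hN⟩ := (h.eventually_lt_const hη).exists
  exact ⟨N, Nat.cast_nonneg N, hN.le⟩

variable [IsProbabilityMeasure P]

/-- Weak law of large numbers for the empirical Gram matrix of the eigenfunctions. -/
lemma tendsto_gram {X : Type*} [MeasurableSpace X] {k : X → X → ℝ} {μ : ℕ → ℝ} {φ : ℕ → X → ℝ}
    {x : ℕ → Ω → X} (hx : ∀ i, Measurable (x i)) (hxi : iIndepFun x P)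
    (hxd : ∀ i, IdentDistrib (x i) (x 0) P P) (hM : IsMercerExpansion (P.map (x 0)) k μ φ)
    (hR : HasRegularSpectrum μ φ) (j l : ℕ) {η : ℝ} (hη : 0 < η) :
    Tendsto (fun n : ℕ => P.real {ω | η < |(fun i : Fin n => φ j (x i ω) / √n) ⬝ᵥ
      (fun i : Fin n => φ l (x i ω) / √n) - if j = l then 1 else 0|}) atTop (𝓝 0) := by
  obtain ⟨B, hB⟩ := hR.bounded
  set g : X → ℝ := fun t => φ j t * φ l t with hg
  have hgm : Measurable g := (hM.measurable j).mul (hM.measurable l)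
  have hlln := strong_law_ae_real (μ := P) (fun i ω => g (x i ω))
    (Integrable.of_bound (hgm.comp (hx 0)).aestronglyMeasurable (B * B) (ae_of_all _ fun ω => by
      rw [Real.norm_eq_abs, abs_mul]
      exact mul_le_mul (hB j _) (hB l _) (abs_nonneg _) ((abs_nonneg _).trans (hB j (x 0 ω)))))
    (fun a b hab => (hxi.indepFun hab).comp hgm hgm)
    (fun i => (hxd i).comp hgm)
  have hint : ∫ ω, g (x 0 ω) ∂P = if j = l then 1 else 0 := by
    rw [← hM.orthonormal j l, integral_map (hx 0).aemeasurable hgm.aestronglyMeasurable]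
  rw [hint] at hlln
  have hmeas := tendstoInMeasure_of_tendsto_ae (μ := P)
    (f := fun (n : ℕ) ω => (∑ i ∈ Finset.range n, g (x i ω)) / n)
    (fun n => ((Finset.measurable_sum _ fun i _ =>
      hgm.comp (hx i)).div_const _).aestronglyMeasurable) hlln
  rw [tendstoInMeasure_iff_measureReal_dist] at hmeas
  refine squeeze_zero (fun n => measureReal_nonneg) (fun n => measureReal_mono ?_) (hmeas η hη)
  intro ω hω
  have h1 : (fun i : Fin n => φ j (x i ω) / √n) ⬝ᵥ (fun i : Fin n => φ l (x i ω) / √n) =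
      (∑ i ∈ Finset.range n, g (x i ω)) / n := by
    rw [Finset.sum_range, Finset.sum_div, dotProduct]
    refine Finset.sum_congr rfl fun i _ => ?_
    rw [div_mul_div_comm, Real.mul_self_sqrt (Nat.cast_nonneg n)]
  have hω' := hω.out
  rw [h1] at hω'
  exact hω'.le

end Events

/-! ### Assembling the probabilistic estimates -/

/-- It suffices to bound the outer measures of the complements. -/
lemma tendsto_measure_one_of_compl {Ω : Type*} [MeasurableSpace Ω] {P : Measure Ω}
    [IsProbabilityMeasure P] {E : ℕ → Set Ω}
    (h : ∀ η : ℝ, 0 < η → ∀ᶠ n in atTop, P.real (E n)ᶜ ≤ η) :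
    Tendsto (fun n => P (E n)) atTop (𝓝 1) := by
  have h0 : Tendsto (fun n => P.real (E n)ᶜ) atTop (𝓝 0) := by
    refine tendsto_order.2 ⟨fun a ha => Eventually.of_forall fun n => ha.trans_le measureReal_nonneg,
      fun a ha => ?_⟩
    filter_upwards [h (a / 2) (half_pos ha)] with n hn
    linarith
  have h1 : Tendsto (fun n => P (E n)ᶜ) atTop (𝓝 0) :=
    (ENNReal.tendsto_toReal_zero_iff fun n => measure_ne_top _ _).1 h0
  have h2 : Tendsto (fun n => 1 - P (E n)ᶜ) atTop (𝓝 1) := by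
    simpa using ENNReal.Tendsto.sub (tendsto_const_nhds (x := (1 : ℝ≥0∞))) h1
      (Or.inl ENNReal.one_ne_top)
  refine tendsto_of_tendsto_of_tendsto_of_le_of_le h2 tendsto_const_nhds (fun n => ?_)
    fun n => prob_le_one
  -- Only subadditivity is used, which holds for nonmeasurable events; `fhat` is not assumed
  -- measurable.
  rw [tsub_le_iff_right, ← measure_univ (μ := P), ← Set.union_compl_self (E n)]
  exact measure_union_le _ _

/-- `n λ + tr(Δ²)` is large once the top empirical eigenfunctions are nearly orthonormal: either
`n λ` is large, or `λ` is small and `K` has many eigenvalues greater than `λ`. -/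
lemma le_trace_add {X : Type*} [MeasurableSpace X] {H : Type*} [NormedAddCommGroup H]
    [InnerProductSpace ℝ H] [CompleteSpace H] [RKHS ℝ H X ℝ] {ν : Measure X} {μ : ℕ → ℝ}
    {φ : ℕ → X → ℝ} (hM : IsMercerExpansion ν (reproducingKernel H) μ φ) {n s N : ℕ}
    {x : Fin n → X} {S : Matrix (Fin s) (Fin n) ℝ} {lam c T : ℝ} (hn : 0 < n) (hl : 0 < lam)
    (hS : KSatisfiable (kernelMatrix (reproducingKernel H) x) S lam c)
    (hG : ∀ j l : Fin N, |(fun i : Fin n => φ j (x i) / √n) ⬝ᵥ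
      (fun i : Fin n => φ l (x i) / √n) - if (j : ℕ) = l then 1 else 0| ≤ 1 / (2 * (N : ℝ)))
    (hNT : T ≤ N * (1 / (2 + 4 * c ^ 2)) ^ 2) (hTn : T / n < μ N / 2) :
    T ≤ (smoother (kernelMatrix (reproducingKernel H) x) S lam *
      smoother (kernelMatrix (reproducingKernel H) x) S lam).trace + n * lam := by
  have hnpos : (0 : ℝ) < n := by exact_mod_cast hn
  have htr := smoother_sq_trace_nonneg (S := S) (lam := lam) (kernelMatrix_transpose (H := H) x)
  by_cases hnl : T ≤ n * lam
  · exact hnl.trans (le_add_of_nonneg_left htr)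
  · have hsmall : lam < μ N / 2 := by
      refine lt_trans ?_ hTn
      rw [lt_div_iff₀ hnpos, mul_comm]
      exact not_le.1 hnl
    have hcard := le_card_topIdx (kernelMatrix_isHermitian H x)
      (fun (j : Fin N) (i : Fin n) => φ j (x i) / √n) (hM.pos N) (hM.form_ge x N)
      (fun j l => by simpa only [Fin.ext_iff] using hG j l) hsmall
    have htop := hS.card_topIdx_le (kernelMatrix_isHermitian H x) (kernelMatrix_form_nonneg _) hl
    have hcard' : (N : ℝ) ≤ ((topIdx (kernelMatrix_isHermitian H x) lam).card : ℝ) := by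
      exact_mod_cast hcard
    have h1 := mul_le_mul_of_nonneg_right hcard' (sq_nonneg (1 / (2 + 4 * c ^ 2)))
    have h2 : 0 ≤ n * lam := by positivity
    linarith

/-- The probability that the noise is not controlled by the variance term. -/
lemma noise_tail {Ω : Type*} [MeasurableSpace Ω] {P : Measure Ω} [IsProbabilityMeasure P]
    {X : Type*} [MeasurableSpace X] {H : Type*} [NormedAddCommGroup H]
    [InnerProductSpace ℝ H] [CompleteSpace H] [RKHS ℝ H X ℝ] {ν : Measure X} {μ : ℕ → ℝ}
    {φ : ℕ → X → ℝ} (hMer : IsMercerExpansion ν (reproducingKernel H) μ φ)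
    {x : ℕ → Ω → X} {ε : ℕ → Ω → ℝ} (hx : ∀ i, Measurable (x i))
    (hεm : ∀ i, Measurable (ε i)) (hεi : iIndepFun ε P) (hεd : ∀ i, IdentDistrib (ε i) (ε 0) P P)
    (hε2 : MemLp (ε 0) 2 P) (hε0 : ∫ ω, ε 0 ω ∂P = 0) (hε1 : ∫ ω, ε 0 ω ^ 2 ∂P = 1)
    {n s : ℕ} {S : Ω → Matrix (Fin s) (Fin n) ℝ} (hSm : ∀ i j, Measurable fun ω => S ω i j)
    (hind : IndepFun (fun ω => ((fun i : Fin n => x i ω), (fun (i : Fin s) (j : Fin n) => S ω i j)))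
      (fun ω (i : Fin n) => ε i ω) P) {lam M η T : ℝ} (hl : 0 ≤ lam) (hM0 : 0 ≤ M) (hη : 0 ≤ η)
    (hM : ∫ ω, (ε 0 ω ^ 2 - min (ε 0 ω ^ 2) M) ∂P ≤ η) (hT : 0 < T) :
    P.real {ω | T ≤ (smoother (kernelMatrix (reproducingKernel H) fun i : Fin n => x i ω)
          (S ω) lam * smoother (kernelMatrix (reproducingKernel H) fun i : Fin n => x i ω)
          (S ω) lam).trace + n * lam ∧
      4 * ((smoother (kernelMatrix (reproducingKernel H) fun i : Fin n => x i ω)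
          (S ω) lam * smoother (kernelMatrix (reproducingKernel H) fun i : Fin n => x i ω)
          (S ω) lam).trace + n * lam) <
        ∑ i : Fin n, ∑ j : Fin n,
          (smoother (kernelMatrix (reproducingKernel H) fun i : Fin n => x i ω) (S ω) lam *
            smoother (kernelMatrix (reproducingKernel H) fun i : Fin n => x i ω) (S ω) lam) i j *
          (ε i ω * ε j ω)} ≤ η + (2 + M ^ 2) / T := by
  have hKm : MeasurableEntries fun z : (Fin n → X) × (Fin s → Fin n → ℝ) =>
      kernelMatrix (reproducingKernel H) z.1 := fun i j => by
    have hij : Measurable fun z : (Fin n → X) × (Fin s → Fin n → ℝ) => (z.1 i, z.1 j) := by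
      fun_prop
    exact (hMer.measurable_kernel.comp hij).const_mul (n : ℝ)⁻¹
  have hSm' : MeasurableEntries fun z : (Fin n → X) × (Fin s → Fin n → ℝ) => Matrix.of z.2 :=
    fun i j => (measurable_pi_apply j).comp ((measurable_pi_apply i).comp measurable_snd)
  have hΔm := hKm.smoother hSm' (fun z => kernelMatrix_transpose z.1) lam
  have hm2 : Measurable fun t : ℝ => t ^ 2 := by fun_prop
  have hmt : Measurable fun t : ℝ => t ^ 2 - min (t ^ 2) M := by fun_prop
  have hZ : Measurable fun ω =>
      ((fun i : Fin n => x i ω), (fun (i : Fin s) (j : Fin n) => S ω i j)) :=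
    Measurable.prodMk (measurable_pi_lambda (fun ω (i : Fin n) => x i ω) fun i => hx i)
      (measurable_pi_lambda (fun ω (i : Fin s) (j : Fin n) => S ω i j) fun i =>
        measurable_pi_lambda _ fun j => hSm i j)
  have ha : 0 ≤ n * lam := by positivity
  have h1 : ∀ i, ∫ ω, ε i ω ^ 2 ∂P = 1 := fun i => ((hεd i).comp hm2).integral_eq.trans hε1
  have h2 : ∀ i, ∫ ω, (ε i ω ^ 2 - min (ε i ω ^ 2) M) ∂P ≤ η := fun i =>
    ((hεd i).comp hmt).integral_eq.trans_le hM
  have key := random_quadForm_tail (P := P) (e := fun i : Fin n => ε i)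
    (fun i => hεm i) (hεi.precomp Fin.val_injective)
    (fun i => (hεd i).integral_eq.trans hε0) (fun i => h1 i)
    (fun i => (hεd i).memLp_iff.2 hε2) hM0 hη (fun i => h2 i) hZ hind (hΔm.mul hΔm)
    (fun z i j => smoother_sq_symm (kernelMatrix_transpose z.1) i j)
    (fun z i => by
      rw [smoother_sq_diag (kernelMatrix_transpose z.1)]
      exact dotProduct_self_nonneg _)
    (fun z => smoother_sq_frobenius_le (kernelMatrix_transpose z.1)
      (kernelMatrix_form_nonneg z.1) hl) ha hT
  exact key

/-- Near orthonormality of the first `N` empirical eigenfunctions. -/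
lemma eventually_gram {Ω : Type*} [MeasurableSpace Ω] {P : Measure Ω} [IsProbabilityMeasure P]
    {X : Type*} [MeasurableSpace X] {k : X → X → ℝ} {μ : ℕ → ℝ} {φ : ℕ → X → ℝ}
    {x : ℕ → Ω → X} (hx : ∀ i, Measurable (x i)) (hxi : iIndepFun x P)
    (hxd : ∀ i, IdentDistrib (x i) (x 0) P P) (hM : IsMercerExpansion (P.map (x 0)) k μ φ)
    (hR : HasRegularSpectrum μ φ) (N : ℕ) {r η : ℝ} (hr : 0 < r) (hη : 0 < η) :
    ∀ᶠ n : ℕ in atTop, P.real {ω | ∃ j l : Fin N, r < |(fun i : Fin n => φ j (x i ω) / √n) ⬝ᵥ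
      (fun i : Fin n => φ l (x i ω) / √n) - if (j : ℕ) = l then 1 else 0|} < η := by
  have h1 := tendsto_finsetSum (Finset.univ : Finset (Fin N)) fun j _ =>
    tendsto_finsetSum (Finset.univ : Finset (Fin N)) fun l _ =>
      tendsto_gram hx hxi hxd hM hR j l hr
  simp only [Finset.sum_const_zero] at h1
  filter_upwards [h1.eventually_lt_const hη] with n hn
  refine lt_of_le_of_lt ?_ hn
  rw [Set.ofPred_exists]
  refine (measureReal_iUnion_fintype_le _).trans (Finset.sum_le_sum fun j _ => ?_)
  rw [Set.ofPred_exists]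
  exact measureReal_iUnion_fintype_le _

end SketchedKRR

theorem corollary4p4 (R c : ℝ) (hc : 0 < c) :
    ∃ C : ℝ, 0 < C ∧
      ∀ (Ω : Type*) [MeasurableSpace Ω] (P : Measure Ω) [IsProbabilityMeasure P]
        (X : Type*) [MeasurableSpace X]
        (H : Type*) [NormedAddCommGroup H] [InnerProductSpace ℝ H] [CompleteSpace H]
        [RKHS ℝ H X ℝ]
        (μ : ℕ → ℝ) (φ : ℕ → X → ℝ) (f₀ : H)
        (x : ℕ → Ω → X) (ε : ℕ → Ω → ℝ)
        (s : ℕ → ℕ) (S : ∀ n, Ω → Matrix (Fin (s n)) (Fin n) ℝ) (lam : ℕ → ℝ)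
        (d : ℝ) (c₁ c₂ : ℝ≥0∞) (fhat : ℕ → Ω → X → ℝ),
        -- the true regression function
        ‖f₀‖ ≤ R →
        -- i.i.d. design points
        (∀ i, Measurable (x i)) → iIndepFun x P → (∀ i, IdentDistrib (x i) (x 0) P P) →
        -- the reproducing kernel and its spectrum
        SketchedKRR.IsMercerExpansion (P.map (x 0)) (SketchedKRR.reproducingKernel H) μ φ →
        SketchedKRR.HasRegularSpectrum μ φ →
        -- i.i.d. noise with mean zero and variance one
        (∀ i, Measurable (ε i)) → iIndepFun ε P → (∀ i, IdentDistrib (ε i) (ε 0) P P) →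
        MemLp (ε 0) 2 P → ∫ ω, ε 0 ω ∂P = 0 → ∫ ω, ε 0 ω ^ 2 ∂P = 1 →
        -- random sketching matrices; the design and the sketch are independent of the noise
        (∀ n i j, Measurable fun ω => S n ω i j) →
        (∀ n, IndepFun
          (fun ω => ((fun i : Fin n => x i ω), (fun (i : Fin (s n)) (j : Fin n) => S n ω i j)))
          (fun ω (i : Fin n) => ε i ω) P) →
        -- range of the smoothing parameter
        (∀ᶠ n : ℕ in atTop, 1 / (n : ℝ) < lam n ∧ lam n < 1) →
        -- the condition on the sketch
        0 < d → 0 < c₁ → 0 < c₂ →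
        SketchedKRR.SketchCondition P (SketchedKRR.reproducingKernel H) μ x s S lam c d c₁ c₂ →
        -- the exceptional probabilities allowed by that condition vanish
        Tendsto (fun n => c₁ * (s n : ℝ≥0∞)) atTop (𝓝 ∞) →
        Tendsto (fun n => c₂ * (SketchedKRR.effDim μ (lam n) : ℝ≥0∞)) atTop (𝓝 ∞) →
        -- the estimator computed from the responses `f₀ (x i) + ε i`
        (∀ᶠ n in atTop, ∀ ω, SketchedKRR.IsSketchedKRR (SketchedKRR.reproducingKernel H)
          (fun i : Fin n => x i ω) (S n ω) (lam n) (fun i : Fin n => f₀ (x i ω) + ε i ω)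
          (fhat n ω)) →
        Tendsto (fun n : ℕ => P {ω |
            SketchedKRR.empNormSq (fun i : Fin n => x i ω) (fun t => fhat n ω t - f₀ t) ≤
              C * (lam n + SketchedKRR.varianceTerm
                (SketchedKRR.kernelMatrix (SketchedKRR.reproducingKernel H)
                  fun i : Fin n => x i ω) (S n ω) (lam n))})
          atTop (𝓝 1) := by
  -- The square of the sum costs a factor 2: 8 is twice the 4 of the noise bound, the rest twice the
  -- bias constant.
  refine ⟨8 + 2 * (R ^ 2 * (3 + 6 * c ^ 2)), by positivity, ?_⟩
  intro Ω _ P _ X _ H _ _ _ _ μ φ f₀ x ε s S lam d c₁ c₂ fhat hf₀ hx hxi hxd hMer hReg hεm hεi hεd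
    hε2 hε0 hε1 hSm hind hlam hd hc₁ hc₂ hsk ha hb hest
  refine SketchedKRR.tendsto_measure_one_of_compl fun η hη => ?_
  -- Five errors of at most η/6 arise: two from the type condition, one from the Gram matrix, two
  -- from the noise (truncation and Chebyshev).
  have hη' : 0 < η / 6 := by positivity
  obtain ⟨M, hM0, hM⟩ := SketchedKRR.exists_truncation (hεm 0) hε2 hη'
  obtain ⟨T, hT, hTb⟩ : ∃ T : ℝ, 0 < T ∧ (2 + M ^ 2) / T = η / 6 :=
    ⟨(2 + M ^ 2) / (η / 6), by positivity, by field_simp⟩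
  -- M, T and N are fixed in this order before n grows, so `μ N` is a constant with which T/n can be
  -- compared.
  obtain ⟨N, hN0, hNT⟩ : ∃ N : ℕ, 0 < N ∧ T ≤ N * (1 / (2 + 4 * c ^ 2)) ^ 2 := by
    obtain ⟨N, hN⟩ := exists_nat_ge (T / (1 / (2 + 4 * c ^ 2)) ^ 2)
    refine ⟨N, ?_, (div_le_iff₀ (by positivity)).1 hN⟩
    have : (0 : ℝ) < N := lt_of_lt_of_le (by positivity) hN
    exact_mod_cast this
  have hG := SketchedKRR.eventually_gram hx hxi hxd hMer hReg N (r := 1 / (2 * (N : ℝ)))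
    (by positivity) hη'
  have hTn := tendsto_const_div_atTop_nhds_zero_nat T
  have hea := (SketchedKRR.tendsto_expNeg ha).eventually_lt_const (lt_min one_pos hη')
  have heb := (SketchedKRR.tendsto_expNeg hb).eventually_lt_const (lt_min one_pos hη')
  filter_upwards [hG, hlam, hsk.type, hea, heb, hest,
    hTn.eventually_lt_const (half_pos (hMer.pos N)),
    eventually_gt_atTop 0] with n hGn hln htype hean hebn hestn hTnn hn
  have hl : 0 < lam n := lt_of_le_of_lt (by positivity) hln.1
  have hE := htype.measureReal_compl_le
    (measurable_pi_lambda _ fun i : Fin n => hx i).comap_le (hean.trans_le (min_le_left _ _))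
    (hebn.trans_le (min_le_left _ _))
  have hQ := SketchedKRR.noise_tail hMer hx hεm hεi hεd hε2 hε0 hε1 (hSm n) (hind n) hl.le hM0
    hη'.le hM hT
  rw [hTb] at hQ
  have hU := (measureReal_union_le _ _).trans
    (add_le_add hE ((measureReal_union_le _ _).trans (add_le_add hGn.le hQ)))
  refine le_trans (measureReal_mono fun ω hω => ?_) (hU.trans ?_)
  · by_contra hcon
    rw [Set.mem_union, Set.mem_union, not_or, not_or, Set.notMem_compl_iff] at hcon
    obtain ⟨hωE, hωG, hωQ⟩ := hcon
    refine hω (SketchedKRR.empNormSq_le (e := fun i : Fin n => ε i ω) hf₀ hn.ne' hl hωE.out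
      (hestn ω) ?_)
    by_contra hlt
    refine hωQ ⟨SketchedKRR.le_trace_add hMer hn hl hωE.out (fun j l => ?_) hNT hTnn,
      not_le.1 hlt⟩
    by_contra hjl
    exact hωG ⟨j, l, not_le.1 hjl⟩
  · have h1 := hean.trans_le (min_le_right _ _)
    have h2 := hebn.trans_le (min_le_right _ _)
    linarith
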